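/- **Theorem 1.** Let $n,m\ge 0$ be integers, and let $\Omega\subseteq\mathbb C^{n+m}$ be a domain (non-empty, open, connected; not necessarily bounded) that is $n$-star-shaped Hartogs in the first $n$ variables: if $(z,z')\in\Omega$, with $z\in\mathbb C^n$ and $z'\in\mathbb C^m$, then $(\lambda_1z_1,\dots,\lambda_nz_n,z')\in\Omega$ for all $\lambda_j\in\mathbb C$ with $|\lambda_j|\le 1$. Let $\alpha_1,\dots,\alpha_n>0$ be real numbers, put $|\alpha|=\alpha_1+\dots+\alpha_n$, and let $$U^\alpha=\Big\{(z,z',w)\in\mathbb C^{n+m}\times\mathbb C:\ |w|<1,\ \Big(\frac{z_1}{(1-|w|^2)^{\alpha_1/2}},\dots,\frac{z_n}{(1-|w|^2)^{\alpha_n/2}},z'\Big)\in\Omega\Big\},$$ and, for $|\eta|<1$, $U^\alpha_\eta=\{(z,z')\in\mathbb C^{n+m}:(z,z',\eta)\in U^\alpha\}$. For an open set $G\subseteq \mathbb C^N$ let $K_G(p;\bar q)$ denote its Bergman kernel: for each $q\in G$, $K_G(\cdot\,;\bar q)$ is the unique square-integrable holomorphic function on $G$ such that $f(q)=\int_G\overline{K_G(p;\bar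 q)}\,f(p)\,dV(p)$ for all square-integrable holomorphic $f$ on $G$ (with $dV$ Lebesgue measure). For $|w|,|\eta|<1$ put $$h(z,w,\eta)=\Big(z_1\Big(\frac{1-|\eta|^2}{1-w\bar\eta}\Big)^{\alpha_1},\dots,z_n\Big(\frac{1-|\eta|^2}{1-w\bar\eta}\Big)^{\alpha_n}\Big),$$ $$D_{U^\alpha}=\frac{(1-|\eta|^2)^{|\alpha|}}{\pi(1-w\bar\eta)^{2+|\alpha|}}\Big(I+\sum_{j=1}^n\alpha_j\Big(I+z_j\frac{\partial}{\partial z_j}\Big)\Big),$$ with principal branches of the powers. Then $U^\alpha$ and its slices $U^\alpha_\eta$ are open, and for all $(z,z',w),(\zeta,\zeta',\eta)\in U^\alpha$ the point $(h(z,w,\eta),z')$ lies in $U^\alpha_\eta$, the function $x\mapsto K_{U^\alpha_\eta}\big(h(x,w,\eta),z';\bar\zeta,\bar\zeta'\big)$ is holomorphic near $x=z$, and $$K_{U^\alpha}(z,z',w;\bar\zeta,\bar\zeta',\bar\eta)=D_{U^\alpha}K_{U^\alpha_\eta}\big(h(z,w,\eta),z';\bar\zeta,\bar\zeta'\big),$$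 where $D_{U^\alpha}$ acts on the right-hand side as a function of $z$, with $w,z',\zeta,\zeta',\eta$ fixed. -/

import Mathlib

open MeasureTheory Metric Filter Topology
open scoped ENNReal ComplexConjugate

namespace Bergman

section Definitions

variable {E : Type*} [NormedAddCommGroup E] [NormedSpace ℂ E] [MeasureSpace E]

/-- `A²(Ω)`: functions holomorphic on `Ω` and square-integrable on `Ω` for Lebesgue measure.
Values outside `Ω` are irrelevant. -/
def bergmanSpace (Ω : Set E) : Set (E → ℂ) :=
  {f | DifferentiableOn ℂ f Ω ∧ MemLp f 2 (volume.restrict Ω)}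

/-- `k ∈ A²(Ω)` is the Riesz representative of evaluation at `ζ`:
`f ζ = ∫_Ω conj (k x) f x dV(x)` for all `f ∈ A²(Ω)`. -/
def IsReproducing (Ω : Set E) (ζ : E) (k : E → ℂ) : Prop :=
  k ∈ bergmanSpace Ω ∧ ∀ f ∈ bergmanSpace Ω, f ζ = ∫ x in Ω, conj (k x) * f x

open Classical in
/-- The Bergman kernel `K_Ω(z; ζ̄)`, for `z, ζ ∈ Ω`: holomorphic in `z`, antiholomorphic in `ζ`.
As a function of `z` it is the Riesz representative of evaluation at `ζ`, which exists and is
unique on `Ω` whenever `Ω` is open (`isReproducing_bergmanKernel`, `IsReproducing.eqOn`). -/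
noncomputable def bergmanKernel (Ω : Set E) (z ζ : E) : ℂ :=
  if h : ∃ k, IsReproducing Ω ζ k then h.choose z else 0

end Definitions

section Existence

variable {E : Type*} [NormedAddCommGroup E] [NormedSpace ℂ E] [FiniteDimensional ℂ E]
  [MeasureSpace E] [BorelSpace E] [(volume : Measure E).IsAddHaarMeasure]

theorem measurePreserving_smul (c : ℂ) (hc : ‖c‖ = 1) :
    MeasurePreserving (fun v : E => c • v) volume volume := by
  have hc0 : c ≠ 0 := by rintro rfl; simp at hc
  have : ProperSpace E := FiniteDimensional.proper ℂ E
  have : SecondCountableTopology E := secondCountable_of_proper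
  let e : E ≃L[ℂ] E := ContinuousLinearEquiv.smulLeft (Units.mk0 c hc0)
  have hm : Measurable (fun v : E => c • v) := (continuous_const_smul c).measurable
  have : (Measure.map (fun v : E => c • v) (volume : Measure E)).IsAddHaarMeasure :=
    e.toContinuousAddEquiv.isAddHaarMeasure_map volume
  refine ⟨hm, ?_⟩
  have h := Measure.isAddLeftInvariant_eq_smul (Measure.map (fun v : E => c • v) (volume : Measure E))
    volume
  have h1 := congrArg (fun μ : Measure E => μ (ball 0 1)) h
  have h2 : (fun v : E => c • v) ⁻¹' ball 0 1 = ball 0 1 := by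
    ext v; simp [norm_smul, hc]
  simp only [Measure.map_apply hm measurableSet_ball, h2, Measure.smul_apply] at h1
  have hpos : (volume (ball (0 : E) 1)) ≠ 0 := (measure_ball_pos _ _ one_pos).ne'
  have hfin : (volume (ball (0 : E) 1)) ≠ ∞ := measure_ball_lt_top.ne
  rw [h]
  set k := Measure.addHaarScalarFactor (Measure.map (fun v : E => c • v) (volume : Measure E))
    volume
  have : k = 1 := by
    have h3 : ((k : ℝ≥0∞)) * volume (ball (0 : E) 1) = 1 * volume (ball (0 : E) 1) := by
      rw [one_mul]; exact h1.symm
    exact_mod_cast (ENNReal.mul_left_inj hpos hfin).1 h3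
  rw [this, one_smul]

theorem integral_closedBall_eq {Ω : Set E} {z : E} {r : ℝ}
    (hz : closedBall z r ⊆ Ω) {f : E → ℂ} (hΩ : IsOpen Ω) (hf : DifferentiableOn ℂ f Ω) :
    ∫ x in closedBall z r, f x = (volume (closedBall (0 : E) r)).toReal • f z := by
  have : ProperSpace E := FiniteDimensional.proper ℂ E
  have : SecondCountableTopology E := secondCountable_of_proper
  set B := closedBall (0 : E) r
  have hB : MeasurableSet B := measurableSet_closedBall
  have hmem : ∀ c : ℂ, ‖c‖ ≤ 1 → ∀ v ∈ B, z + c • v ∈ Ω := by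
    intro c hc v hv
    apply hz
    have : ‖c • v‖ ≤ r := by
      rw [norm_smul]
      have : ‖v‖ ≤ r := by simpa [B] using hv
      nlinarith [norm_nonneg v]
    simpa [mem_closedBall, dist_eq_norm] using this
  set I := ∫ v in B, f (z + v)
  have h0 : ∫ x in closedBall z r, f x = I := by
    have := (measurePreserving_add_left (volume : Measure E) z).setIntegral_preimage_emb
      (measurableEmbedding_addLeft z) f (closedBall z r)
    rw [← this]
    have : (fun x => z + x) ⁻¹' closedBall z r = B := by
      ext v; simp [B, mem_closedBall, dist_eq_norm]
    rw [this]
  have hrot : ∀ t : ℝ, ∫ v in B, f (z + circleMap 0 1 t • v) = I := by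
    intro t
    have hc : ‖circleMap 0 1 t‖ = 1 := by simp
    have hc0 : circleMap 0 1 t ≠ 0 := by intro h; rw [h] at hc; simp at hc
    have hpre : (fun v : E => circleMap 0 1 t • v) ⁻¹' B = B := by
      ext v; simp [B, norm_smul]
    have := (measurePreserving_smul (E := E) _ hc).setIntegral_preimage_emb
      (Homeomorph.smulOfNeZero _ hc0).measurableEmbedding (fun v => f (z + v)) B
    rw [hpre] at this
    exact this
  have hmv : ∀ v ∈ B, ∫ t in (0 : ℝ)..2 * Real.pi, f (z + circleMap 0 1 t • v)
      = (2 * Real.pi) • f z := by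
    intro v hv
    have hd : DiffContOnCl ℂ (fun c : ℂ => f (z + c • v)) (ball 0 |1|) := by
      apply DifferentiableOn.diffContOnCl
      intro c hc
      have hc' : ‖c‖ ≤ 1 := by
        have := closure_ball_subset_closedBall hc
        simpa using this
      have h1 : DifferentiableAt ℂ f (z + c • v) :=
        hf.differentiableAt (hΩ.mem_nhds (hmem c hc' v hv))
      exact (DifferentiableAt.comp c h1 (by fun_prop)).differentiableWithinAt
    have := hd.circleAverage
    simp only [Real.circleAverage_def, zero_smul, add_zero] at this
    rw [inv_smul_eq_iff₀ (by positivity)] at this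
    exact this
  have hcont : ContinuousOn (fun p : ℝ × E => f (z + circleMap 0 1 p.1 • p.2))
      (Set.Icc 0 (2 * Real.pi) ×ˢ B) := by
    apply hf.continuousOn.comp
    · have : Continuous (circleMap 0 1) := continuous_circleMap 0 1
      fun_prop
    · rintro ⟨t, v⟩ ⟨-, hv⟩
      exact hmem _ (by simp) v hv
  have hint : Integrable (fun p : ℝ × E => f (z + circleMap 0 1 p.1 • p.2))
      ((volume.restrict (Set.Ioc 0 (2 * Real.pi))).prod (volume.restrict B)) := by
    rw [Measure.prod_restrict]
    exact (hcont.integrableOn_compact (isCompact_Icc.prod (isCompact_closedBall _ _))).mono_set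
      (Set.prod_mono Set.Ioc_subset_Icc_self le_rfl)
  have hsw := integral_integral_swap (f := fun (t : ℝ) (v : E) => f (z + circleMap 0 1 t • v)) hint
  simp only [hrot] at hsw
  have h3 : ∫ v in B, ∫ t in Set.Ioc 0 (2 * Real.pi), f (z + circleMap 0 1 t • v)
      = ∫ v in B, (2 * Real.pi) • f z := by
    apply setIntegral_congr_fun hB
    intro v hv
    have := hmv v hv
    rwa [intervalIntegral.integral_of_le (by positivity)] at this
  rw [h3] at hsw
  simp only [integral_const, Measure.real, Measure.restrict_apply_univ, Real.volume_Ioc, sub_zero,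
    ENNReal.toReal_ofReal (by positivity : (0 : ℝ) ≤ 2 * Real.pi)] at hsw
  rw [smul_comm] at hsw
  rw [h0]
  exact smul_right_injective ℂ (by positivity : (2 * Real.pi : ℝ) ≠ 0) hsw

theorem norm_le_eLpNorm {Ω : Set E} (hΩ : IsOpen Ω) {z : E} {r : ℝ} (hr : 0 < r)
    (hz : closedBall z r ⊆ Ω) {f : E → ℂ} (hf : DifferentiableOn ℂ f Ω)
    (hf2 : MemLp f 2 (volume.restrict Ω)) :
    ‖f z‖ ≤ ((volume (closedBall (0 : E) r)).toReal)⁻¹ *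
      ((volume (closedBall (0 : E) r)) ^ (1 / 2 : ℝ)).toReal *
      (eLpNorm f 2 (volume.restrict Ω)).toReal := by
  have : ProperSpace E := FiniteDimensional.proper ℂ E
  have hV : volume (closedBall z r) = volume (closedBall (0 : E) r) :=
    Measure.addHaar_closedBall_center _ _ _
  set V := volume (closedBall (0 : E) r)
  have hVpos : 0 < V := measure_closedBall_pos _ _ hr
  have hVfin : V ≠ ∞ := measure_closedBall_lt_top.ne
  have hVr : 0 < V.toReal := ENNReal.toReal_pos hVpos.ne' hVfin
  have hmono : volume.restrict (closedBall z r) ≤ volume.restrict Ω :=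
    Measure.restrict_mono hz le_rfl
  have hfB : MemLp f 2 (volume.restrict (closedBall z r)) := hf2.mono_measure hmono
  have h1 := integral_closedBall_eq hz hΩ hf
  have h2 : ‖∫ x in closedBall z r, f x‖ₑ ≤ eLpNorm f 2 (volume.restrict Ω) * V ^ (1 / 2 : ℝ) := by
    calc _ ≤ ∫⁻ x in closedBall z r, ‖f x‖ₑ := enorm_integral_le_lintegral_enorm _
      _ = eLpNorm f 1 (volume.restrict (closedBall z r)) := eLpNorm_one_eq_lintegral_enorm.symm
      _ ≤ _ := eLpNorm_le_eLpNorm_mul_rpow_measure_univ (q := 2) (by norm_num) hfB.1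
      _ ≤ _ := by
        rw [Measure.restrict_apply_univ, hV]
        norm_num
        gcongr
  have h3 := ENNReal.toReal_mono (ENNReal.mul_ne_top hf2.2.ne
    (ENNReal.rpow_ne_top_of_nonneg (by norm_num) hVfin)) h2
  rw [h1, ENNReal.toReal_mul, toReal_enorm, norm_smul, Real.norm_of_nonneg hVr.le] at h3
  rw [mul_assoc, le_inv_mul_iff₀ hVr]
  linarith [h3]


theorem exists_holomorphic_of_tendsto {Ω : Set E} (hΩ : IsOpen Ω) {f : ℕ → E → ℂ}
    (hf : ∀ i, f i ∈ bergmanSpace Ω) {g : Lp ℂ 2 (volume.restrict Ω)}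
    (hg : Tendsto (fun i => (hf i).2.toLp (f i)) atTop (𝓝 g)) :
    ∃ F : E → ℂ, DifferentiableOn ℂ F Ω ∧ g =ᵐ[volume.restrict Ω] F := by
  have : ProperSpace E := FiniteDimensional.proper ℂ E
  -- the sequence is uniformly Cauchy on small balls
  have hcau : ∀ r > 0, ∀ s : Set E, (∀ y ∈ s, closedBall y r ⊆ Ω) →
      UniformCauchySeqOn f atTop s := by
    intro r hr s hs
    rw [Metric.uniformCauchySeqOn_iff]
    intro ε hε
    set C := ((volume (closedBall (0 : E) r)).toReal)⁻¹ *
      ((volume (closedBall (0 : E) r)) ^ (1 / 2 : ℝ)).toReal with hC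
    have hC0 : 0 ≤ C := by positivity
    obtain ⟨N, hN⟩ := Metric.cauchySeq_iff.1 hg.cauchySeq (ε / (C + 1)) (by positivity)
    refine ⟨N, fun i hi j hj y hy => ?_⟩
    have h1 := hN i hi j hj
    rw [dist_eq_norm, ← MemLp.toLp_sub, Lp.norm_toLp] at h1
    have h2 := norm_le_eLpNorm hΩ hr (hs y hy) ((hf i).1.sub (hf j).1) ((hf i).2.sub (hf j).2)
    rw [← hC] at h2
    rw [dist_eq_norm]
    calc _ ≤ _ := h2
      _ ≤ C * (ε / (C + 1)) := by gcongr
      _ < ε := by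
        rw [mul_div_assoc', div_lt_iff₀ (by positivity)]; nlinarith
  have hball : ∀ z ∈ Ω, ∃ r > 0, ∀ y ∈ ball z r, closedBall y (2 * r) ⊆ Ω := by
    intro z hz
    obtain ⟨ε, hε, h⟩ := Metric.isOpen_iff.1 hΩ z hz
    refine ⟨ε / 4, by positivity, fun y hy x hx => h ?_⟩
    rw [mem_ball] at hy ⊢
    rw [mem_closedBall] at hx
    linarith [dist_triangle x y z]
  have hself : ∀ {y : E} {r : ℝ}, 0 < r → y ∈ closedBall y r := fun h => mem_closedBall_self h.le
  have hlim : ∀ z : E, ∃ l : ℂ, z ∈ Ω → Tendsto (fun i => f i z) atTop (𝓝 l) := by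
    intro z
    by_cases hz : z ∈ Ω
    · obtain ⟨r, hr, h⟩ := hball z hz
      obtain ⟨l, hl⟩ := cauchySeq_tendsto_of_complete
        ((hcau (2 * r) (by positivity) (ball z r) h).cauchySeq (mem_ball_self hr))
      exact ⟨l, fun _ => hl⟩
    · exact ⟨0, fun h => absurd h hz⟩
  choose F hF using hlim
  refine ⟨F, ?_, ?_⟩
  · intro z hz
    obtain ⟨r, hr, h⟩ := hball z hz
    have hsub : ball z r ⊆ Ω := fun y hy => h y hy (hself (by positivity))
    have hder : UniformCauchySeqOn (fun i => fderiv ℂ (f i)) atTop (ball z (r / 2)) := by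
      rw [Metric.uniformCauchySeqOn_iff]
      intro ε hε
      obtain ⟨N, hN⟩ := Metric.uniformCauchySeqOn_iff.1
        (hcau (2 * r) (by positivity) (ball z r) h) (ε * r / 8) (by positivity)
      refine ⟨N, fun i hi j hj y hy => ?_⟩
      have hsub2 : ball y (r / 2) ⊆ ball z r := by
        apply ball_subset_ball'
        rw [mem_ball] at hy; linarith
      have hyΩ : Ω ∈ 𝓝 y := hΩ.mem_nhds (hsub (hsub2 (mem_ball_self (by positivity))))
      have hmaps : Set.MapsTo (f i - f j) (ball y (r / 2))
          (closedBall ((f i - f j) y) (ε * r / 4)) := by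
        intro x hx
        have h1 := hN i hi j hj x (hsub2 hx)
        have h2 := hN i hi j hj y (hsub2 (mem_ball_self (by positivity)))
        rw [dist_eq_norm] at h1 h2
        rw [mem_closedBall, dist_eq_norm]
        refine (norm_sub_le _ _).trans ?_
        simp only [Pi.sub_apply]
        linarith
      have h3 := Complex.norm_fderiv_le_div_of_mapsTo_ball
        (((hf i).1.sub (hf j).1).mono (hsub2.trans hsub)) hmaps (by positivity)
      rw [fderiv_sub ((hf i).1.differentiableAt hyΩ) ((hf j).1.differentiableAt hyΩ)] at h3
      rw [dist_eq_norm]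
      refine h3.trans_lt ?_
      rw [div_lt_iff₀ (by positivity)]
      nlinarith
    have hL : ∀ y : E, ∃ L : E →L[ℂ] ℂ, y ∈ ball z (r / 2) →
        Tendsto (fun i => fderiv ℂ (f i) y) atTop (𝓝 L) := by
      intro y
      by_cases hy : y ∈ ball z (r / 2)
      · obtain ⟨l, hl⟩ := cauchySeq_tendsto_of_complete (hder.cauchySeq hy)
        exact ⟨l, fun _ => hl⟩
      · exact ⟨0, fun h => absurd h hy⟩
    choose L hL using hL
    have hsub3 : ball z (r / 2) ⊆ Ω := (ball_subset_ball (by linarith)).trans hsub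
    have := hasFDerivAt_of_tendstoUniformlyOn (x := z) isOpen_ball
      (hder.tendstoUniformlyOn_of_tendsto hL)
      (fun i x hx => ((hf i).1.differentiableAt (hΩ.mem_nhds (hsub3 hx))).hasFDerivAt)
      (fun x hx => hF x (hsub3 hx)) (mem_ball_self (by positivity))
    exact this.differentiableAt.differentiableWithinAt
  · obtain ⟨ns, hns, hae⟩ := (tendstoInMeasure_of_tendsto_Lp hg).exists_seq_tendsto_ae
    have h1 : ∀ᵐ x ∂(volume.restrict Ω), ∀ i, ((hf i).2.toLp (f i) : E → ℂ) x = f i x :=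
      ae_all_iff.2 fun i => (hf i).2.coeFn_toLp
    filter_upwards [hae, h1, ae_restrict_mem hΩ.measurableSet] with x hx1 hx2 hx3
    simp only [hx2] at hx1
    exact tendsto_nhds_unique hx1 ((hF x hx3).comp hns.tendsto_atTop)

theorem eqOn_of_ae_eq {E : Type*} [NormedAddCommGroup E] [NormedSpace ℂ E] [MeasureSpace E]
    [OpensMeasurableSpace E] [(volume : Measure E).IsOpenPosMeasure] {Ω : Set E} (hΩ : IsOpen Ω) {f g : E → ℂ} (hf : DifferentiableOn ℂ f Ω)
    (hg : DifferentiableOn ℂ g Ω) (h : f =ᵐ[volume.restrict Ω] g) : Set.EqOn f g Ω :=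
  Measure.eqOn_open_of_ae_eq h hΩ hf.continuousOn hg.continuousOn

/-- Evaluation at a point of an open set is represented by an element of the Bergman space. -/
theorem exists_isReproducing {Ω : Set E} (hΩ : IsOpen Ω) {z : E} (hz : z ∈ Ω) :
    ∃ k, IsReproducing Ω z k := by
  let A : Submodule ℂ (Lp ℂ 2 (volume.restrict Ω)) :=
    { carrier := {g | ∃ F : E → ℂ, DifferentiableOn ℂ F Ω ∧ g =ᵐ[volume.restrict Ω] F}
      zero_mem' := ⟨0, differentiableOn_const 0, Lp.coeFn_zero _ _ _⟩
      add_mem' := by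
        rintro a b ⟨F, hF, hF'⟩ ⟨G, hG, hG'⟩
        exact ⟨F + G, hF.add hG, (Lp.coeFn_add a b).trans (hF'.add hG')⟩
      smul_mem' := by
        rintro c a ⟨F, hF, hF'⟩
        exact ⟨c • F, hF.const_smul c, (Lp.coeFn_smul c a).trans (hF'.const_smul c)⟩ }
  have hA : ∀ {g : Lp ℂ 2 (volume.restrict Ω)}, g ∈ A ↔
      ∃ F : E → ℂ, DifferentiableOn ℂ F Ω ∧ g =ᵐ[volume.restrict Ω] F := Iff.rfl
  have hmem : ∀ {g : Lp ℂ 2 (volume.restrict Ω)} {F : E → ℂ}, g =ᵐ[volume.restrict Ω] F →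
      MemLp F 2 (volume.restrict Ω) := fun h => (memLp_congr_ae h).1 (Lp.memLp _)
  have hclosed : IsClosed (A : Set (Lp ℂ 2 (volume.restrict Ω))) := by
    apply IsSeqClosed.isClosed
    intro u g hu hug
    choose f hf hf' using hu
    have hf2 : ∀ i, f i ∈ bergmanSpace Ω := fun i => ⟨hf i, hmem (hf' i)⟩
    refine exists_holomorphic_of_tendsto hΩ hf2 (g := g) ?_
    have : (fun i => (hf2 i).2.toLp (f i)) = u := by
      funext i
      exact Lp.ext ((hf2 i).2.coeFn_toLp.trans (hf' i).symm)
    rwa [this]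
  have : CompleteSpace A := hclosed.completeSpace_coe
  choose rep hrep hrep' using fun g : A => hA.1 g.2
  have huniq : ∀ (g : A) (F : E → ℂ), DifferentiableOn ℂ F Ω →
      (g : Lp ℂ 2 (volume.restrict Ω)) =ᵐ[volume.restrict Ω] F → rep g z = F z :=
    fun g F hF hF' => eqOn_of_ae_eq hΩ (hrep g) hF ((hrep' g).symm.trans hF') hz
  obtain ⟨r, hr, hball⟩ := Metric.nhds_basis_closedBall.mem_iff.1 (hΩ.mem_nhds hz)
  let ev : A →ₗ[ℂ] ℂ :=
    { toFun := fun g => rep g z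
      map_add' := fun a b => huniq (a + b) (rep a + rep b) ((hrep a).add (hrep b))
        ((Lp.coeFn_add _ _).trans ((hrep' a).add (hrep' b)))
      map_smul' := fun c a => huniq (c • a) (c • rep a) ((hrep a).const_smul c)
        ((Lp.coeFn_smul _ _).trans ((hrep' a).const_smul c)) }
  let evc : A →L[ℂ] ℂ := ev.mkContinuous _ (fun g => by
    have := norm_le_eLpNorm hΩ hr hball (hrep g) (hmem (hrep' g))
    rw [← eLpNorm_congr_ae (hrep' g), ← Lp.norm_def] at this
    exact this)
  let k := (InnerProductSpace.toDual ℂ A).symm evc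
  refine ⟨rep k, ⟨hrep k, hmem (hrep' k)⟩, fun f hf => ?_⟩
  let g : A := ⟨hf.2.toLp f, hA.2 ⟨f, hf.1, hf.2.coeFn_toLp⟩⟩
  have h1 : inner ℂ k g = rep g z := InnerProductSpace.toDual_symm_apply
  rw [huniq g f hf.1 hf.2.coeFn_toLp, Submodule.coe_inner, L2.inner_def] at h1
  rw [← h1]
  apply integral_congr_ae
  filter_upwards [hrep' k, hf.2.coeFn_toLp] with x hx1 hx2
  rw [hx1, show ((g : Lp ℂ 2 (volume.restrict Ω)) : E → ℂ) x = f x from hx2]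
  simp [mul_comm]

/-- The representing function is unique on `Ω`. -/
theorem IsReproducing.eqOn {Ω : Set E} (hΩ : IsOpen Ω) {z : E} {k l : E → ℂ}
    (hk : IsReproducing Ω z k) (hl : IsReproducing Ω z l) : Set.EqOn k l Ω := by
  have hint : ∀ {a b : E → ℂ}, a ∈ bergmanSpace Ω → b ∈ bergmanSpace Ω →
      Integrable (fun x => conj (a x) * b x) (volume.restrict Ω) := fun ha hb =>
    MemLp.integrable_mul (p := 2) (q := 2) ha.2.star hb.2
  have hd : (k - l) ∈ bergmanSpace Ω := ⟨hk.1.1.sub hl.1.1, hk.1.2.sub hl.1.2⟩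
  have h0 : ∫ x in Ω, conj ((k - l) x) * (k - l) x = 0 := by
    have h1 := hk.2 _ hd
    have h2 := hl.2 _ hd
    have : ∀ x, conj ((k - l) x) * (k - l) x
        = conj (k x) * (k - l) x - conj (l x) * (k - l) x := by
      intro x; simp [sub_mul]
    simp_rw [this]
    rw [integral_sub (hint hk.1 hd) (hint hl.1 hd), ← h1, ← h2, sub_self]
  have h1 : (fun x => conj ((k - l) x) * (k - l) x) = fun x => ((‖(k - l) x‖ ^ 2 : ℝ) : ℂ) := by
    funext x; rw [mul_comm, Complex.mul_conj']; norm_cast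
  rw [h1, integral_complex_ofReal, Complex.ofReal_eq_zero,
    integral_eq_zero_iff_of_nonneg (fun _ => by positivity)] at h0
  · refine eqOn_of_ae_eq hΩ hk.1.1 hl.1.1 ?_
    filter_upwards [h0] with x hx
    simpa [sub_eq_zero] using hx
  · exact hd.2.integrable_norm_pow (by norm_num)

theorem isReproducing_bergmanKernel {Ω : Set E} (hΩ : IsOpen Ω) {ζ : E} (hζ : ζ ∈ Ω) :
    IsReproducing Ω ζ (fun z => bergmanKernel Ω z ζ) := by
  have h := exists_isReproducing hΩ hζ
  have : (fun z => bergmanKernel Ω z ζ) = h.choose := by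
    funext z
    simp only [bergmanKernel, dif_pos h]
  rw [this]
  exact h.choose_spec

/-- Lebesgue measure on `ℂⁿ × ℂᵐ` is a Haar measure. -/
instance isAddHaarMeasure_volume_prod {n m : ℕ} :
    (volume : Measure ((Fin n → ℂ) × (Fin m → ℂ))).IsAddHaarMeasure :=
  Measure.prod.instIsAddHaarMeasure _ _

/-- Lebesgue measure on `(ℂⁿ × ℂᵐ) × ℂ` is a Haar measure. -/
instance isAddHaarMeasure_volume_prod_prod {n m : ℕ} :
    (volume : Measure (((Fin n → ℂ) × (Fin m → ℂ)) × ℂ)).IsAddHaarMeasure :=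
  Measure.prod.instIsAddHaarMeasure _ _

end Existence

section Hartogs

variable {n m : ℕ}

/-- A domain `Ω ⊆ ℂⁿ × ℂᵐ` is `n`-star-shaped Hartogs in the first `n` variables. -/
structure IsStarShapedHartogs (Ω : Set ((Fin n → ℂ) × (Fin m → ℂ))) : Prop where
  isOpen : IsOpen Ω
  isConnected : IsConnected Ω
  scale_mem : ∀ z z', (z, z') ∈ Ω → ∀ c : Fin n → ℂ, (∀ j, ‖c j‖ ≤ 1) →
    ((fun j => c j * z j), z') ∈ Ω

/-- `f_α(z, w) = (z_j / (1 - |w|²)^{α_j / 2})_j`. -/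
noncomputable def fMap (α : Fin n → ℝ) (z : Fin n → ℂ) (w : ℂ) : Fin n → ℂ :=
  fun j => z j / (((1 - ‖w‖ ^ 2) ^ (α j / 2) : ℝ) : ℂ)

/-- `U^α = {(z, z', w) : (f_α(z, w), z') ∈ Ω, |w| < 1}`. -/
def domainU (α : Fin n → ℝ) (Ω : Set ((Fin n → ℂ) × (Fin m → ℂ))) :
    Set (((Fin n → ℂ) × (Fin m → ℂ)) × ℂ) :=
  {p | (fMap α p.1.1 p.2, p.1.2) ∈ Ω ∧ ‖p.2‖ < 1}

/-- The slice `{(z, z') : (z, z', η) ∈ U}`. -/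
def slice (U : Set (((Fin n → ℂ) × (Fin m → ℂ)) × ℂ)) (η : ℂ) :
    Set ((Fin n → ℂ) × (Fin m → ℂ)) :=
  {q | (q, η) ∈ U}

/-- `h(z, w, η) = (z_j ((1 - |η|²) / (1 - w η̄))^{α_j})_j`, with the principal branch of the power
(for `|w|, |η| < 1` the base has positive real part). -/
noncomputable def hMap (α : Fin n → ℝ) (z : Fin n → ℂ) (w η : ℂ) : Fin n → ℂ :=
  fun j => z j * (((1 - ‖η‖ ^ 2 : ℝ) : ℂ) / (1 - w * conj η)) ^ (α j : ℂ)

/-- The complex partial derivative `∂F/∂z_j` at `z`. -/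
noncomputable def partialDeriv (j : Fin n) (F : (Fin n → ℂ) → ℂ) (z : Fin n → ℂ) : ℂ :=
  deriv (fun t => F (Function.update z j t)) (z j)

/-- The first order operator
`(1-|η|²)^{∑ α_j} / (π (1 - w η̄)^{2 + ∑ α_j}) (I + ∑_j α_j (I + z_j ∂/∂z_j))`
applied to a function `F` of `z`, and evaluated at `z`. -/
noncomputable def operatorD (α : Fin n → ℝ) (w η : ℂ) (F : (Fin n → ℂ) → ℂ)
    (z : Fin n → ℂ) : ℂ :=
  (((1 - ‖η‖ ^ 2) ^ (∑ j, α j) : ℝ) : ℂ) /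
      ((Real.pi : ℂ) * (1 - w * conj η) ^ ((2 + ∑ j, α j : ℝ) : ℂ)) *
    (F z + ∑ j, (α j : ℂ) * (F z + z j * partialDeriv j F z))

end Hartogs

end Bergman

/-!
The kernel of `U = U^α` is found by testing it against explicit functions. For `w` in the disc,
`ρ = √(1 - |w|²)` and `p ∈ Ω`, let
`f (y, v) = (1 - v w̄) ^ (-2 - |α|) K_Ω((ρ / (1 - v w̄)) ^ α y ; p)` (`pullbackKernel`). It lies in
`A²(U)`, and for every `k ∈ A²(U)` and every `q` in the slice over `w`, with `p = ρ ^ (-α) q`,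

  `∫_U conj f · k = π ∫₀¹ t ^ |α| k (t ^ α q, w) dt`

(`IsStarShapedHartogs.integral_conj_pullbackKernel_mul`). To see this, integrate over the slices and
rescale each slice to `Ω`. A dilation of ratio `|σ| ≤ 1` can be moved from one variable of `K_Ω` to
the other (`IsStarShapedHartogs.bergmanKernel_dil_cpw`): for unimodular ratios this is invariance
under the torus action, and the general case follows by the identity theorem. Hence the
reproducing property in `Ω` evaluates the inner integral, and an integral over the disc remains.
After the disc automorphism `v = (u + w) / (1 + u w̄)` its integrand depends on `u` only through a
holomorphic function on each circle `|u| = r`, so the mean value property leaves the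
radial integral.

For `k = K_U(· ; ζ, η)` the left-hand side is `conj (f (ζ, η))`, that is, up to an explicit factor,
the kernel of the slice over `η` at `h (·, w, η)`
(`IsStarShapedHartogs.bergmanKernel_slice_eq_integral`). So, up to that factor, the slice
kernel is the average `∫₀¹ t ^ |α| k (t ^ α z) dt`, and this averaging is inverted by the weighted Euler operator
`I + ∑ α_j (I + z_j ∂/∂z_j)`, because `s ^ (1 + |α|) ∫₀¹ t ^ |α| k ((s t) ^ α z) dt` equals
`∫₀^s t ^ |α| k (t ^ α z) dt` (`euler_eq_of_integral`).
-/

namespace Bergman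

/-! ### Dilations and symmetry of the kernel -/

section Dilations

variable {n m : ℕ}

/-- The diagonal dilation `(z, z') ↦ (c₁ z₁, …, cₙ zₙ, z')` of `ℂⁿ × ℂᵐ`. -/
def dil (c : Fin n → ℂ) (q : (Fin n → ℂ) × (Fin m → ℂ)) : (Fin n → ℂ) × (Fin m → ℂ) :=
  (fun j => c j * q.1 j, q.2)

theorem dil_dil (c d : Fin n → ℂ) (q : (Fin n → ℂ) × (Fin m → ℂ)) :
    dil c (dil d q) = dil (c * d) q := by
  simp [dil, mul_assoc]

theorem dil_one (q : (Fin n → ℂ) × (Fin m → ℂ)) : dil 1 q = q := by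
  simp [dil]

theorem dil_inv_dil {c : Fin n → ℂ} (hc : ∀ j, c j ≠ 0) (q : (Fin n → ℂ) × (Fin m → ℂ)) :
    dil c⁻¹ (dil c q) = q := by
  rw [dil_dil, show c⁻¹ * c = 1 by ext j; simp [hc j], dil_one]

theorem dil_dil_inv {c : Fin n → ℂ} (hc : ∀ j, c j ≠ 0) (q : (Fin n → ℂ) × (Fin m → ℂ)) :
    dil c (dil c⁻¹ q) = q := by
  rw [dil_dil, show c * c⁻¹ = 1 by ext j; simp [hc j], dil_one]

theorem differentiable_dil (c : Fin n → ℂ) :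
    Differentiable ℂ (dil c : (Fin n → ℂ) × (Fin m → ℂ) → _) := by
  unfold dil
  fun_prop

theorem continuous_dil (c : Fin n → ℂ) :
    Continuous (dil c : (Fin n → ℂ) × (Fin m → ℂ) → _) :=
  (differentiable_dil c).continuous

/-- A dilation with nonzero ratios, as a homeomorphism. -/
noncomputable def dilHomeomorph (c : Fin n → ℂ) (hc : ∀ j, c j ≠ 0) :
    ((Fin n → ℂ) × (Fin m → ℂ)) ≃ₜ ((Fin n → ℂ) × (Fin m → ℂ)) where
  toFun := dil c
  invFun := dil c⁻¹
  left_inv := dil_inv_dil hc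
  right_inv := dil_dil_inv hc
  continuous_toFun := continuous_dil c
  continuous_invFun := continuous_dil c⁻¹

theorem measurableEmbedding_dil {c : Fin n → ℂ} (hc : ∀ j, c j ≠ 0) :
    MeasurableEmbedding (dil c : (Fin n → ℂ) × (Fin m → ℂ) → _) :=
  (dilHomeomorph c hc).measurableEmbedding

theorem abs_det_mulLeft (c : ℂ) : |LinearMap.det (LinearMap.mulLeft ℝ c)| = ‖c‖ ^ 2 := by
  have h : LinearMap.det (LinearMap.mulLeft ℝ c) = Complex.normSq c :=
    Algebra.norm_complex_apply c
  rw [h, abs_of_nonneg (Complex.normSq_nonneg c), Complex.normSq_eq_norm_sq]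

/-- Lebesgue measure scales by `∏ |c_j|²`, the real Jacobian of a complex dilation. -/
theorem map_dil_volume {c : Fin n → ℂ} (hc : ∀ j, c j ≠ 0) :
    ENNReal.ofReal (∏ j, ‖c j‖ ^ 2) • Measure.map (dil c)
      (volume : Measure ((Fin n → ℂ) × (Fin m → ℂ))) = volume := by
  have hpi : ENNReal.ofReal (∏ j, ‖c j‖ ^ 2) •
      Measure.map (fun z : Fin n → ℂ => fun j => c j * z j) volume = volume := by
    symm
    rw [volume_pi]
    apply Measure.pi_eq
    intro s hs
    have hm : Measurable (fun z : Fin n → ℂ => fun j => c j * z j) := by fun_prop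
    have hpre : (fun z : Fin n → ℂ => fun j => c j * z j) ⁻¹' Set.univ.pi s
        = Set.univ.pi fun j => (LinearMap.mulLeft ℝ (c j)) ⁻¹' s j := by
      ext z; simp
    rw [Measure.smul_apply, Measure.map_apply hm (MeasurableSet.univ_pi hs), hpre, Measure.pi_pi,
      smul_eq_mul, ENNReal.ofReal_prod_of_nonneg (fun j _ => by positivity),
      ← Finset.prod_mul_distrib]
    refine Finset.prod_congr rfl fun j _ => ?_
    have h0 : (0 : ℝ) < ‖c j‖ ^ 2 := by have := norm_pos_iff.2 (hc j); positivity
    have hd := abs_det_mulLeft (c j)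
    have hd0 : LinearMap.det (LinearMap.mulLeft ℝ (c j)) ≠ 0 := by
      intro h
      rw [h, abs_zero] at hd
      exact h0.ne hd
    rw [Measure.addHaar_preimage_linearMap volume hd0, ← mul_assoc, abs_inv, hd,
      ← ENNReal.ofReal_mul h0.le, mul_inv_cancel₀ h0.ne', ENNReal.ofReal_one, one_mul]
  have hmap : Measure.map (dil c) (volume : Measure ((Fin n → ℂ) × (Fin m → ℂ)))
      = (Measure.map (fun z : Fin n → ℂ => fun j => c j * z j) volume).prod volume := by
    have := Measure.map_prod_map (volume : Measure (Fin n → ℂ)) (volume : Measure (Fin m → ℂ))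
      (f := fun z : Fin n → ℂ => fun j => c j * z j) (g := id) (by fun_prop) measurable_id
    rw [Measure.map_id] at this
    rw [this]
    rfl
  rw [hmap, ← Measure.prod_smul_left, hpi]
  rfl

theorem restrict_volume_eq_map_dil {c : Fin n → ℂ} (hc : ∀ j, c j ≠ 0)
    (S : Set ((Fin n → ℂ) × (Fin m → ℂ))) :
    volume.restrict S = ENNReal.ofReal (∏ j, ‖c j‖ ^ 2) •
      Measure.map (dil c) (volume.restrict (dil c ⁻¹' S)) := by
  conv_lhs => rw [← map_dil_volume hc]
  rw [Measure.restrict_smul, (measurableEmbedding_dil hc).restrict_map]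

theorem setIntegral_dil {c : Fin n → ℂ} (hc : ∀ j, c j ≠ 0)
    (S : Set ((Fin n → ℂ) × (Fin m → ℂ))) (g : (Fin n → ℂ) × (Fin m → ℂ) → ℂ) :
    ∫ q in S, g q = ((∏ j, ‖c j‖ ^ 2 : ℝ) : ℂ) * ∫ q in dil c ⁻¹' S, g (dil c q) := by
  rw [restrict_volume_eq_map_dil hc S, integral_smul_measure,
    (measurableEmbedding_dil hc).integral_map, ENNReal.toReal_ofReal (by positivity),
    Complex.real_smul]

theorem setLIntegral_dil {c : Fin n → ℂ} (hc : ∀ j, c j ≠ 0)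
    (S : Set ((Fin n → ℂ) × (Fin m → ℂ))) (g : (Fin n → ℂ) × (Fin m → ℂ) → ℝ≥0∞) :
    ∫⁻ q in S, g q = ENNReal.ofReal (∏ j, ‖c j‖ ^ 2) * ∫⁻ q in dil c ⁻¹' S, g (dil c q) := by
  rw [restrict_volume_eq_map_dil hc S, lintegral_smul_measure,
    (measurableEmbedding_dil hc).lintegral_map, smul_eq_mul]

theorem prod_norm_sq_pos {c : Fin n → ℂ} (hc : ∀ j, c j ≠ 0) : 0 < ∏ j, ‖c j‖ ^ 2 :=
  Finset.prod_pos fun j _ => by have := norm_pos_iff.2 (hc j); positivity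

theorem memLp_comp_dil {c : Fin n → ℂ} (hc : ∀ j, c j ≠ 0)
    {S : Set ((Fin n → ℂ) × (Fin m → ℂ))} {g : (Fin n → ℂ) × (Fin m → ℂ) → ℂ}
    (hg : MemLp g 2 (volume.restrict S)) :
    MemLp (fun q => g (dil c q)) 2 (volume.restrict (dil c ⁻¹' S)) := by
  have h0 := prod_norm_sq_pos hc
  rw [restrict_volume_eq_map_dil hc S] at hg
  have h1 := hg.smul_measure (c := (ENNReal.ofReal (∏ j, ‖c j‖ ^ 2))⁻¹) (by simp [h0])
  rw [smul_smul, ENNReal.inv_mul_cancel (by simp [h0]) ENNReal.ofReal_ne_top, one_smul] at h1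
  exact (measurableEmbedding_dil hc).memLp_map_measure_iff.1 h1

theorem comp_dil_mem_bergmanSpace {c : Fin n → ℂ} (hc : ∀ j, c j ≠ 0)
    {S : Set ((Fin n → ℂ) × (Fin m → ℂ))} {g : (Fin n → ℂ) × (Fin m → ℂ) → ℂ}
    (hg : g ∈ bergmanSpace S) : (fun q => g (dil c q)) ∈ bergmanSpace (dil c ⁻¹' S) :=
  ⟨hg.1.comp (differentiable_dil c).differentiableOn fun _ h => h, memLp_comp_dil hc hg.2⟩

theorem preimage_dil_inv_preimage_dil {c : Fin n → ℂ} (hc : ∀ j, c j ≠ 0)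
    (S : Set ((Fin n → ℂ) × (Fin m → ℂ))) : dil c⁻¹ ⁻¹' (dil c ⁻¹' S) = S := by
  ext q; simp [dil_dil_inv hc]

/-- Transformation rule of the Bergman kernel under dilations. -/
theorem bergmanKernel_dil {c : Fin n → ℂ} (hc : ∀ j, c j ≠ 0)
    {S : Set ((Fin n → ℂ) × (Fin m → ℂ))} (hS : IsOpen S) {q p : (Fin n → ℂ) × (Fin m → ℂ)}
    (hq : dil c q ∈ S) (hp : dil c p ∈ S) :
    bergmanKernel (dil c ⁻¹' S) q p =
      ((∏ j, ‖c j‖ ^ 2 : ℝ) : ℂ) * bergmanKernel S (dil c q) (dil c p) := by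
  have hS' : IsOpen (dil c ⁻¹' S) := hS.preimage (continuous_dil c)
  have hk := isReproducing_bergmanKernel hS hp
  have hl : IsReproducing (dil c ⁻¹' S) p
      fun q => ((∏ j, ‖c j‖ ^ 2 : ℝ) : ℂ) * bergmanKernel S (dil c q) (dil c p) := by
    have := comp_dil_mem_bergmanSpace hc hk.1
    refine ⟨⟨this.1.const_mul _, this.2.const_mul _⟩, fun f hf => ?_⟩
    have hc' : ∀ j, c⁻¹ j ≠ 0 := fun j => by simpa using hc j
    have hf' := comp_dil_mem_bergmanSpace hc' hf
    rw [preimage_dil_inv_preimage_dil hc] at hf'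
    have h1 := hk.2 _ hf'
    simp only [dil_inv_dil hc] at h1
    rw [h1, setIntegral_dil hc, ← integral_const_mul]
    refine integral_congr_ae (Eventually.of_forall fun x => ?_)
    simp only [dil_inv_dil hc, map_mul, Complex.conj_ofReal, mul_assoc]
  exact (isReproducing_bergmanKernel hS' hp).eqOn hS' hl hq

end Dilations

section Symmetry

variable {E : Type*} [NormedAddCommGroup E] [NormedSpace ℂ E] [FiniteDimensional ℂ E]
  [MeasureSpace E] [BorelSpace E] [(volume : Measure E).IsAddHaarMeasure]

theorem bergmanKernel_conj_symm {S : Set E} (hS : IsOpen S) {q p : E} (hq : q ∈ S) (hp : p ∈ S) :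
    bergmanKernel S q p = conj (bergmanKernel S p q) := by
  have hkq := isReproducing_bergmanKernel hS hq
  have hkp := isReproducing_bergmanKernel hS hp
  rw [hkq.2 _ hkp.1, hkp.2 _ hkq.1, ← integral_conj]
  refine integral_congr_ae (Eventually.of_forall fun x => ?_)
  simp [mul_comm]

/-- The reproducing property with the roles of the two factors exchanged. -/
theorem integral_conj_mul_bergmanKernel {S : Set E} (hS : IsOpen S) {p : E} (hp : p ∈ S)
    {f : E → ℂ} (hf : f ∈ bergmanSpace S) :
    ∫ x in S, conj (f x) * bergmanKernel S x p = conj (f p) := by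
  rw [(isReproducing_bergmanKernel hS hp).2 f hf, ← integral_conj]
  refine integral_congr_ae (Eventually.of_forall fun x => ?_)
  simp [mul_comm]

theorem differentiableOn_bergmanKernel {S : Set E} (hS : IsOpen S) {p : E} (hp : p ∈ S) :
    DifferentiableOn ℂ (fun q => bergmanKernel S q p) S :=
  (isReproducing_bergmanKernel hS hp).1.1

end Symmetry

/-! ### Weighted powers and dilations in one variable of the kernel -/

section Powers

variable {n m : ℕ}

/-- The vector of principal powers `(σ ^ α₁, …, σ ^ αₙ)`. -/
noncomputable def cpw (α : Fin n → ℝ) (σ : ℂ) : Fin n → ℂ := fun j => σ ^ (α j : ℂ)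

theorem cpw_ne_zero (α : Fin n → ℝ) {σ : ℂ} (hσ : σ ≠ 0) (j : Fin n) : cpw α σ j ≠ 0 := by
  simp [cpw, Complex.cpow_eq_zero_iff, hσ]

theorem cpow_ofReal_mul {r : ℝ} (hr : 0 < r) {σ : ℂ} (hσ : σ ≠ 0) (a : ℂ) :
    ((r : ℂ) * σ) ^ a = (r : ℂ) ^ a * σ ^ a := by
  have hr' : (r : ℂ) ≠ 0 := by exact_mod_cast hr.ne'
  rw [Complex.cpow_def_of_ne_zero (mul_ne_zero hr' hσ), Complex.cpow_def_of_ne_zero hr',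
    Complex.cpow_def_of_ne_zero hσ, Complex.log_ofReal_mul hr hσ, Complex.ofReal_log hr.le,
    add_mul, Complex.exp_add]

theorem cpw_ofReal_mul (α : Fin n → ℝ) {r : ℝ} (hr : 0 < r) {σ : ℂ} (hσ : σ ≠ 0) :
    cpw α ((r : ℂ) * σ) = cpw α (r : ℂ) * cpw α σ := by
  ext j; exact cpow_ofReal_mul hr hσ _

theorem cpw_one (α : Fin n → ℝ) : cpw α 1 = 1 := by
  ext j; simp [cpw]

theorem norm_cpw (α : Fin n → ℝ) (σ : ℂ) (j : Fin n) : ‖cpw α σ j‖ = ‖σ‖ ^ α j :=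
  Complex.norm_cpow_real _ _

theorem prod_norm_cpw_sq (α : Fin n → ℝ) {σ : ℂ} (hσ : σ ≠ 0) :
    ∏ j, ‖cpw α σ j‖ ^ 2 = (‖σ‖ ^ 2) ^ ∑ j, α j := by
  have h : 0 < ‖σ‖ := norm_pos_iff.2 hσ
  rw [Real.rpow_sum_of_pos (by positivity)]
  refine Finset.prod_congr rfl fun j _ => ?_
  rw [norm_cpw, ← Real.rpow_natCast, ← Real.rpow_natCast, ← Real.rpow_mul h.le,
    ← Real.rpow_mul h.le, mul_comm]

theorem arg_ne_pi_of_re_pos {x : ℂ} (hx : 0 < x.re) : x.arg ≠ Real.pi := fun h => by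
  have := (Complex.arg_eq_pi_iff.1 h).1
  linarith

theorem conj_cpow_ofReal {x : ℂ} (hx : 0 < x.re) (a : ℝ) :
    conj (x ^ (a : ℂ)) = (conj x) ^ (a : ℂ) := by
  rw [Complex.conj_cpow _ _ (arg_ne_pi_of_re_pos hx), Complex.conj_ofReal]

theorem star_cpw (α : Fin n → ℝ) {σ : ℂ} (hσ : 0 < σ.re) : star (cpw α σ) = cpw α (conj σ) := by
  ext j
  exact conj_cpow_ofReal hσ (α j)

theorem norm_cpw_le_one {α : Fin n → ℝ} (hα : ∀ j, 0 < α j) {σ : ℂ} (hσ : ‖σ‖ ≤ 1)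
    (j : Fin n) : ‖cpw α σ j‖ ≤ 1 := by
  rw [norm_cpw]
  exact Real.rpow_le_one (norm_nonneg _) hσ (hα j).le

end Powers

section Dilation

variable {n m : ℕ} {Ω : Set ((Fin n → ℂ) × (Fin m → ℂ))}

theorem IsStarShapedHartogs.dil_mem (hΩ : IsStarShapedHartogs Ω)
    {q : (Fin n → ℂ) × (Fin m → ℂ)} (hq : q ∈ Ω) {c : Fin n → ℂ} (hc : ∀ j, ‖c j‖ ≤ 1) :
    dil c q ∈ Ω :=
  hΩ.scale_mem q.1 q.2 hq c hc

theorem IsStarShapedHartogs.preimage_dil_of_norm_eq_one (hΩ : IsStarShapedHartogs Ω)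
    {c : Fin n → ℂ} (hc : ∀ j, ‖c j‖ = 1) : dil c ⁻¹' Ω = Ω := by
  have hc0 : ∀ j, c j ≠ 0 := fun j => norm_pos_iff.1 (by rw [hc j]; exact one_pos)
  ext q
  refine ⟨fun h => ?_, fun h => hΩ.dil_mem h fun j => (hc j).le⟩
  rw [← dil_inv_dil hc0 q]
  exact hΩ.dil_mem h fun j => by simp [hc j]

/-- Invariance of the kernel under the torus action. -/
theorem IsStarShapedHartogs.bergmanKernel_torus (hΩ : IsStarShapedHartogs Ω)
    {q p : (Fin n → ℂ) × (Fin m → ℂ)} (hq : q ∈ Ω) (hp : p ∈ Ω) {c : Fin n → ℂ}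
    (hc : ∀ j, ‖c j‖ = 1) :
    bergmanKernel Ω (dil c q) p = bergmanKernel Ω q (dil (star c) p) := by
  have hc0 : ∀ j, c j ≠ 0 := fun j => norm_pos_iff.1 (by rw [hc j]; exact one_pos)
  have h1 : dil c (dil (star c) p) = p := by
    rw [dil_dil, show c * star c = 1 by ext j; simp [Complex.mul_conj', hc j], dil_one]
  have h := bergmanKernel_dil (q := q) (p := dil (star c) p) hc0 hΩ.isOpen
    (hΩ.dil_mem hq fun j => (hc j).le) (by rwa [h1])
  rw [hΩ.preimage_dil_of_norm_eq_one hc, h1] at h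
  simpa [hc] using h.symm

/-- A weighted dilation `z_j ↦ σ ^ α_j z_j` with `|σ| ≤ 1` may be moved from one variable of the
kernel to the other. Writing `σ = exp (iτ)`, both sides are holomorphic in `τ` near the closed
upper half-plane, and they agree for real `τ`, where the dilation is unitary. -/
theorem IsStarShapedHartogs.bergmanKernel_dil_cpw (hΩ : IsStarShapedHartogs Ω)
    {α : Fin n → ℝ} (hα : ∀ j, 0 < α j)
    {q p : (Fin n → ℂ) × (Fin m → ℂ)} (hq : q ∈ Ω) (hp : p ∈ Ω) {σ : ℂ} (hσ0 : σ ≠ 0)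
    (hσ : ‖σ‖ ≤ 1) :
    bergmanKernel Ω (dil (cpw α σ) q) p = bergmanKernel Ω q (dil (star (cpw α σ)) p) := by
  let c : ℂ → Fin n → ℂ := fun τ j => Complex.exp (Complex.I * τ * α j)
  have hcd : ∀ p : (Fin n → ℂ) × (Fin m → ℂ), Differentiable ℂ fun τ => dil (c τ) p := by
    intro p; unfold c dil; fun_prop
  have hnorm : ∀ τ j, ‖c τ j‖ = Real.exp (-τ.im * α j) := by
    intro τ j
    simp [c, Complex.norm_exp]
  have hle : ∀ τ : ℂ, 0 ≤ τ.im → ∀ j, ‖c τ j‖ ≤ 1 := by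
    intro τ hτ j
    rw [hnorm, Real.exp_le_one_iff]
    nlinarith [hα j]
  have hstar : ∀ τ, star (c τ) = c (-conj τ) := by
    intro τ; ext j
    simp only [Pi.star_apply, c]
    rw [Complex.star_def, ← Complex.exp_conj]
    simp
  -- the function `τ ↦ K (c τ • x, y)` is analytic near the closed upper half-plane
  have key : ∀ x ∈ Ω, ∀ y ∈ Ω, DifferentiableOn ℂ (fun τ => bergmanKernel Ω (dil (c τ) x) y)
      ((fun τ => dil (c τ) x) ⁻¹' Ω) := fun x _ y hy =>
    (differentiableOn_bergmanKernel hΩ.isOpen hy).comp (hcd x).differentiableOn fun _ h => h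
  have hopen : ∀ x, IsOpen ((fun τ => dil (c τ) x) ⁻¹' Ω) := fun x =>
    hΩ.isOpen.preimage (hcd x).continuous
  let H : Set ℂ := {τ | 0 ≤ τ.im}
  have hH : ∀ x ∈ Ω, H ⊆ (fun τ => dil (c τ) x) ⁻¹' Ω := fun x hx τ hτ => hΩ.dil_mem hx (hle τ hτ)
  have hf : AnalyticOnNhd ℂ (fun τ => bergmanKernel Ω (dil (c τ) q) p) H :=
    ((key q hq p hp).analyticOnNhd (hopen q)).mono (hH q hq)
  have hg : AnalyticOnNhd ℂ (fun τ => conj (bergmanKernel Ω (dil (c (-conj τ)) p) q)) H := by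
    have h1 : DifferentiableOn ℂ (fun τ => bergmanKernel Ω (dil (c (-τ)) p) q)
        ((fun τ => -τ) ⁻¹' ((fun τ => dil (c τ) p) ⁻¹' Ω)) :=
      (key p hp q hq).comp (by fun_prop) fun _ h => h
    have ho1 := (hopen p).preimage (continuous_neg (G := ℂ))
    have ho2 := ho1.preimage Complex.continuous_conj
    have h2 : DifferentiableOn ℂ (fun τ => conj (bergmanKernel Ω (dil (c (-conj τ)) p) q))
        (conj ⁻¹' ((fun τ => -τ) ⁻¹' ((fun τ => dil (c τ) p) ⁻¹' Ω))) := by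
      intro τ hτ
      have := (h1.differentiableAt (ho1.mem_nhds hτ)).conj_conj
      simp only [Complex.conj_conj] at this
      exact this.differentiableWithinAt
    refine (h2.analyticOnNhd ho2).mono fun τ hτ => ?_
    exact hH p hp (show 0 ≤ (-conj τ).im by simpa [H] using hτ)
  have hpre : IsPreconnected H := (convex_halfSpace_im_ge 0).isPreconnected
  have hreal : ∀ t : ℝ, bergmanKernel Ω (dil (c t) q) p
      = conj (bergmanKernel Ω (dil (c (-conj (t : ℂ))) p) q) := by
    intro t
    have h1 : ∀ j, ‖c t j‖ = 1 := fun j => by simp [hnorm]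
    rw [hΩ.bergmanKernel_torus hq hp h1, ← hstar, bergmanKernel_conj_symm hΩ.isOpen hq]
    exact hΩ.dil_mem hp fun j => by simp [h1]
  have hfreq : ∃ᶠ τ in 𝓝[≠] (0 : ℂ), bergmanKernel Ω (dil (c τ) q) p
      = conj (bergmanKernel Ω (dil (c (-conj τ)) p) q) := by
    have ht : Tendsto (fun t : ℝ => (t : ℂ)) (𝓝[≠] 0) (𝓝[≠] (0 : ℂ)) := by
      refine tendsto_nhdsWithin_iff.2 ⟨?_, ?_⟩
      · exact (Complex.continuous_ofReal.tendsto' 0 0 rfl).mono_left nhdsWithin_le_nhds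
      · filter_upwards [self_mem_nhdsWithin] with t ht
        simpa using ht
    exact ht.frequently (Eventually.of_forall hreal).frequently
  have heq := hf.eqOn_of_preconnected_of_frequently_eq hg hpre (by simp [H]) hfreq
  have hτ : (-Complex.I * Complex.log σ) ∈ H := by
    simp only [H, Set.mem_ofPred_eq, neg_mul, Complex.neg_im, Complex.I_mul_im, Complex.log_re]
    have := Real.log_nonpos (norm_nonneg _) hσ
    linarith
  have h := heq hτ
  have hcσ : c (-Complex.I * Complex.log σ) = cpw α σ := by
    ext j
    simp only [c, cpw, Complex.cpow_def_of_ne_zero hσ0]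
    congr 1
    ring_nf
    simp
  simp only [← hstar, hcσ] at h
  rw [h, ← bergmanKernel_conj_symm hΩ.isOpen hq]
  exact hΩ.dil_mem hp fun j => by simpa using norm_cpw_le_one hα hσ j

end Dilation

/-! ### Geometry of the domain and integration over slices -/

section Disc

/-- The radius factor `√(1 - |v|²)` of the slice over `v`. -/
noncomputable def rad (v : ℂ) : ℝ := √(1 - ‖v‖ ^ 2)

theorem one_sub_norm_sq_pos {v : ℂ} (hv : ‖v‖ < 1) : 0 < 1 - ‖v‖ ^ 2 := by
  nlinarith [norm_nonneg v]

theorem rad_pos {v : ℂ} (hv : ‖v‖ < 1) : 0 < rad v := Real.sqrt_pos.2 (one_sub_norm_sq_pos hv)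

theorem rad_sq {v : ℂ} (hv : ‖v‖ < 1) : rad v ^ 2 = 1 - ‖v‖ ^ 2 :=
  Real.sq_sqrt (one_sub_norm_sq_pos hv).le

theorem re_one_sub_pos {x : ℂ} (hx : ‖x‖ < 1) : 0 < (1 - x).re := by
  have := (Complex.re_le_norm x).trans_lt hx
  simpa using this

theorem norm_mul_conj_lt_one {v b : ℂ} (hv : ‖v‖ < 1) (hb : ‖b‖ < 1) : ‖v * conj b‖ < 1 := by
  rw [norm_mul, RCLike.norm_conj]
  nlinarith [norm_nonneg v, norm_nonneg b]

theorem re_one_sub_mul_conj_pos {v b : ℂ} (hv : ‖v‖ < 1) (hb : ‖b‖ < 1) :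
    0 < (1 - v * conj b).re :=
  re_one_sub_pos (norm_mul_conj_lt_one hv hb)

theorem ne_zero_of_re_pos {x : ℂ} (hx : 0 < x.re) : x ≠ 0 := by
  rintro rfl; simp at hx

theorem one_sub_mul_conj_ne_zero {v b : ℂ} (hv : ‖v‖ < 1) (hb : ‖b‖ < 1) :
    1 - v * conj b ≠ 0 :=
  ne_zero_of_re_pos (re_one_sub_mul_conj_pos hv hb)

theorem norm_one_sub_mul_conj_sq (v b : ℂ) :
    ‖1 - v * conj b‖ ^ 2 = (1 - ‖v‖ ^ 2) * (1 - ‖b‖ ^ 2) + ‖v - b‖ ^ 2 := by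
  simp only [← Complex.normSq_eq_norm_sq, Complex.normSq_apply]
  simp
  ring

theorem rad_mul_rad_le {v b : ℂ} (hv : ‖v‖ < 1) (hb : ‖b‖ < 1) :
    rad v * rad b ≤ ‖1 - v * conj b‖ := by
  have h := norm_one_sub_mul_conj_sq v b
  rw [← rad_sq hv, ← rad_sq hb] at h
  refine le_of_sq_le_sq ?_ (norm_nonneg _)
  nlinarith [sq_nonneg ‖v - b‖]

end Disc

section Geometry

variable {n m : ℕ} {Ω : Set ((Fin n → ℂ) × (Fin m → ℂ))} {α : Fin n → ℝ}

theorem fMap_eq_dil (α : Fin n → ℝ) (q : (Fin n → ℂ) × (Fin m → ℂ)) {v : ℂ} (hv : ‖v‖ < 1) :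
    (fMap α q.1 v, q.2) = dil (cpw α ((rad v)⁻¹ : ℝ)) q := by
  ext j
  · simp only [fMap, dil, cpw, rad]
    rw [div_eq_mul_inv, mul_comm, ← Complex.ofReal_inv, ← Complex.ofReal_cpow (by positivity),
      Real.sqrt_eq_rpow, Real.inv_rpow (by have := one_sub_norm_sq_pos hv; positivity),
      ← Real.rpow_mul (one_sub_norm_sq_pos hv).le]
    ring_nf
  · rfl

theorem hMap_eq_dil (α : Fin n → ℝ) (q : (Fin n → ℂ) × (Fin m → ℂ)) (w η : ℂ) :
    (hMap α q.1 w η, q.2) = dil (cpw α (((1 - ‖η‖ ^ 2 : ℝ) : ℂ) / (1 - w * conj η))) q := by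
  ext j
  · simp only [hMap, dil, cpw, mul_comm]
  · rfl

theorem mem_domainU_iff {q : (Fin n → ℂ) × (Fin m → ℂ)} {v : ℂ} :
    (q, v) ∈ domainU α Ω ↔ ‖v‖ < 1 ∧ dil (cpw α ((rad v)⁻¹ : ℝ)) q ∈ Ω := by
  constructor
  · rintro ⟨h1, h2⟩
    exact ⟨h2, by rw [← fMap_eq_dil α q h2]; exact h1⟩
  · rintro ⟨h2, h1⟩
    rw [← fMap_eq_dil α q h2] at h1
    exact ⟨h1, h2⟩

theorem slice_domainU {v : ℂ} (hv : ‖v‖ < 1) :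
    slice (domainU α Ω) v = dil (cpw α ((rad v)⁻¹ : ℝ)) ⁻¹' Ω := by
  ext q
  simp [slice, mem_domainU_iff, hv]

theorem isOpen_domainU (hΩ : IsOpen Ω) (α : Fin n → ℝ) : IsOpen (domainU α Ω) := by
  have ho : IsOpen {p : ((Fin n → ℂ) × (Fin m → ℂ)) × ℂ | ‖p.2‖ < 1} :=
    isOpen_lt (by fun_prop) continuous_const
  have hc : ContinuousOn (fun p : ((Fin n → ℂ) × (Fin m → ℂ)) × ℂ => (fMap α p.1.1 p.2, p.1.2))
      {p | ‖p.2‖ < 1} := by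
    refine ContinuousOn.prodMk (continuousOn_pi.2 fun j => ?_) (by fun_prop)
    refine ContinuousOn.div (by fun_prop) ?_ fun p hp => ?_
    · refine Complex.continuous_ofReal.comp_continuousOn ?_
      refine ContinuousOn.rpow_const (by fun_prop) fun p hp => ?_
      exact Or.inl (one_sub_norm_sq_pos hp).ne'
    · have := Real.rpow_pos_of_pos (one_sub_norm_sq_pos hp) (α j / 2)
      exact_mod_cast this.ne'
  have := hc.isOpen_inter_preimage ho hΩ
  convert this using 1
  ext p
  simp [domainU, and_comm]

theorem isOpen_slice {U : Set (((Fin n → ℂ) × (Fin m → ℂ)) × ℂ)} (hU : IsOpen U) (v : ℂ) :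
    IsOpen (slice U v) :=
  hU.preimage (by fun_prop : Continuous fun q : (Fin n → ℂ) × (Fin m → ℂ) => (q, v))

theorem inv_rad_ne_zero {v : ℂ} (hv : ‖v‖ < 1) : (((rad v)⁻¹ : ℝ) : ℂ) ≠ 0 := by
  exact_mod_cast (inv_pos.2 (rad_pos hv)).ne'

theorem rad_ne_zero {v : ℂ} (hv : ‖v‖ < 1) : ((rad v : ℝ) : ℂ) ≠ 0 := by
  exact_mod_cast (rad_pos hv).ne'

theorem dil_cpw_ofReal_mul (α : Fin n → ℝ) {r : ℝ} (hr : 0 < r) {σ : ℂ} (hσ : σ ≠ 0)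
    (q : (Fin n → ℂ) × (Fin m → ℂ)) :
    dil (cpw α (r : ℂ)) (dil (cpw α σ) q) = dil (cpw α ((r : ℂ) * σ)) q := by
  rw [dil_dil, cpw_ofReal_mul α hr hσ]

theorem dil_cpw_mul_ofReal (α : Fin n → ℝ) {r : ℝ} (hr : 0 < r) {σ : ℂ} (hσ : σ ≠ 0)
    (q : (Fin n → ℂ) × (Fin m → ℂ)) :
    dil (cpw α σ) (dil (cpw α (r : ℂ)) q) = dil (cpw α ((r : ℂ) * σ)) q := by
  rw [dil_dil, cpw_ofReal_mul α hr hσ, mul_comm]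

/-- A weighted dilation of ratio `τ` maps the slice over `v` into the domain dilated by
`|τ| √(1 - |v|²)`. -/
theorem IsStarShapedHartogs.dil_cpw_mem_of_slice (hΩ : IsStarShapedHartogs Ω)
    (hα : ∀ j, 0 < α j) {q : (Fin n → ℂ) × (Fin m → ℂ)} {v τ : ℂ} (hq : (q, v) ∈ domainU α Ω)
    (hτ0 : τ ≠ 0) (hτ : ‖τ‖ * rad v ≤ 1) : dil (cpw α τ) q ∈ Ω := by
  obtain ⟨hv, hq⟩ := mem_domainU_iff.1 hq
  have h0 := rad_pos hv
  have h1 : dil (cpw α τ) q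
      = dil (cpw α ((rad v : ℂ) * τ)) (dil (cpw α ((rad v)⁻¹ : ℝ)) q) := by
    rw [dil_cpw_mul_ofReal α (inv_pos.2 h0) (mul_ne_zero (rad_ne_zero hv) hτ0), ← mul_assoc]
    congr 2
    rw [Complex.ofReal_inv, inv_mul_cancel₀ (rad_ne_zero hv), one_mul]
  rw [h1]
  refine hΩ.dil_mem hq fun j => norm_cpw_le_one hα ?_ j
  rw [norm_mul, Complex.norm_real, Real.norm_of_nonneg h0.le, mul_comm]
  exact hτ

theorem IsStarShapedHartogs.dil_cpw_mem_domainU (hΩ : IsStarShapedHartogs Ω)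
    (hα : ∀ j, 0 < α j) {q : (Fin n → ℂ) × (Fin m → ℂ)} {v v' τ : ℂ}
    (hq : (q, v) ∈ domainU α Ω) (hv' : ‖v'‖ < 1) (hτ0 : τ ≠ 0) (hτ : ‖τ‖ * rad v ≤ rad v') :
    (dil (cpw α τ) q, v') ∈ domainU α Ω := by
  have h0 := rad_pos hv'
  refine mem_domainU_iff.2 ⟨hv', ?_⟩
  rw [dil_cpw_ofReal_mul α (inv_pos.2 h0) hτ0]
  refine hΩ.dil_cpw_mem_of_slice hα hq (mul_ne_zero (inv_rad_ne_zero hv') hτ0) ?_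
  rw [norm_mul, Complex.norm_real, Real.norm_of_nonneg (by positivity), mul_assoc,
    inv_mul_le_iff₀ h0, mul_one]
  exact hτ

end Geometry

section Fubini

variable {n m : ℕ} {Ω : Set ((Fin n → ℂ) × (Fin m → ℂ))} {α : Fin n → ℝ}

theorem lintegral_domainU (hΩ : IsOpen Ω) {g : ((Fin n → ℂ) × (Fin m → ℂ)) × ℂ → ℝ≥0∞}
    (hg : AEMeasurable g (volume.restrict (domainU α Ω))) :
    ∫⁻ x in domainU α Ω, g x
      = ∫⁻ v in ball 0 1, ∫⁻ q in slice (domainU α Ω) v, g (q, v) := by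
  have hU := isOpen_domainU hΩ α
  rw [← lintegral_indicator hU.measurableSet, Measure.volume_eq_prod, lintegral_prod_symm,
    ← lintegral_indicator measurableSet_ball]
  · congr 1
    ext v
    by_cases hv : ‖v‖ < 1
    · rw [Set.indicator_of_mem (by simpa using hv),
        ← lintegral_indicator (isOpen_slice hU v).measurableSet]
      rfl
    · rw [Set.indicator_of_notMem (by simpa using hv)]
      have : ∀ q, (domainU α Ω).indicator g (q, v) = 0 := fun q =>
        Set.indicator_of_notMem (fun h => hv h.2) _
      simp [this]
  · exact (aemeasurable_indicator_iff hU.measurableSet).2 hg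

theorem integral_indicator_domainU (hΩ : IsOpen Ω)
    (g : ((Fin n → ℂ) × (Fin m → ℂ)) × ℂ → ℂ) (v : ℂ) :
    ∫ q, (domainU α Ω).indicator g (q, v)
      = (ball 0 1).indicator (fun v => ∫ q in slice (domainU α Ω) v, g (q, v)) v := by
  have hU := isOpen_domainU hΩ α
  by_cases hv : ‖v‖ < 1
  · rw [Set.indicator_of_mem (by simpa using hv),
      ← integral_indicator (isOpen_slice hU v).measurableSet]
    rfl
  · rw [Set.indicator_of_notMem (by simpa using hv)]
    have : ∀ q, (domainU α Ω).indicator g (q, v) = 0 := fun q =>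
      Set.indicator_of_notMem (fun h => hv h.2) _
    simp [this]

theorem integral_domainU (hΩ : IsOpen Ω) {g : ((Fin n → ℂ) × (Fin m → ℂ)) × ℂ → ℂ}
    (hg : IntegrableOn g (domainU α Ω)) :
    ∫ x in domainU α Ω, g x
      = ∫ v in ball 0 1, ∫ q in slice (domainU α Ω) v, g (q, v) := by
  have hU := isOpen_domainU hΩ α
  have hg' := (integrable_indicator_iff hU.measurableSet).2 hg
  rw [← integral_indicator hU.measurableSet, Measure.volume_eq_prod, integral_prod_symm _ hg',
    ← integral_indicator measurableSet_ball]
  simp only [integral_indicator_domainU hΩ]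

theorem integrableOn_integral_slice (hΩ : IsOpen Ω)
    {g : ((Fin n → ℂ) × (Fin m → ℂ)) × ℂ → ℂ} (hg : IntegrableOn g (domainU α Ω)) :
    IntegrableOn (fun v => ∫ q in slice (domainU α Ω) v, g (q, v)) (ball 0 1) := by
  have hU := isOpen_domainU hΩ α
  have hg' := (integrable_indicator_iff hU.measurableSet).2 hg
  rw [Measure.volume_eq_prod] at hg'
  have := hg'.integral_prod_right
  simp only [integral_indicator_domainU hΩ] at this
  exact (integrable_indicator_iff measurableSet_ball).1 this

theorem enorm_sq_lintegral_lt_top {X : Type*} [MeasurableSpace X] {μ : Measure X} {f : X → ℂ}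
    (hf : MemLp f 2 μ) : ∫⁻ x, ‖f x‖ₑ ^ 2 ∂μ < ∞ := by
  have := lintegral_rpow_enorm_lt_top_of_eLpNorm_lt_top (by norm_num) (by norm_num) hf.2
  simpa using this

theorem memLp_two_of_lintegral {X : Type*} [MeasurableSpace X] {μ : Measure X} {f : X → ℂ}
    (hf : AEStronglyMeasurable f μ) (h : ∫⁻ x, ‖f x‖ₑ ^ 2 ∂μ < ∞) : MemLp f 2 μ := by
  refine ⟨hf, ?_⟩
  rw [eLpNorm_lt_top_iff_lintegral_rpow_enorm_lt_top (by norm_num) (by norm_num)]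
  simpa using h

/-- Almost all slices of a Bergman space function belong to the Bergman space of the slice. -/
theorem ae_slice_mem_bergmanSpace (hΩ : IsOpen Ω)
    {k : ((Fin n → ℂ) × (Fin m → ℂ)) × ℂ → ℂ} (hk : k ∈ bergmanSpace (domainU α Ω)) :
    ∀ᵐ v ∂(volume.restrict (ball (0 : ℂ) 1)),
      (fun q => k (q, v)) ∈ bergmanSpace (slice (domainU α Ω) v) := by
  have hU := isOpen_domainU hΩ α
  have h1 := enorm_sq_lintegral_lt_top hk.2
  have hm : AEMeasurable (fun x => ‖k x‖ₑ ^ 2) (volume.restrict (domainU α Ω)) :=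
    hk.2.1.enorm.pow_const 2
  have hdiff : ∀ v, DifferentiableOn ℂ (fun q => k (q, v)) (slice (domainU α Ω) v) := fun v =>
    hk.1.comp (by fun_prop : Differentiable ℂ fun q : (Fin n → ℂ) × (Fin m → ℂ) =>
      (q, v)).differentiableOn fun _ h => h
  have hm' := (aemeasurable_indicator_iff hU.measurableSet).2 hm
  rw [← lintegral_indicator hU.measurableSet, Measure.volume_eq_prod,
    lintegral_prod_symm _ hm'] at h1
  have h2 := ae_lt_top' hm'.lintegral_prod_left' h1.ne
  filter_upwards [ae_restrict_of_ae h2] with v hv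
  have hs := (isOpen_slice hU v)
  refine ⟨hdiff v, memLp_two_of_lintegral
    ((hdiff v).continuousOn.aestronglyMeasurable hs.measurableSet) ?_⟩
  rw [← lintegral_indicator hs.measurableSet]
  exact hv

end Fubini

/-! ### The pulled back kernel -/

section TestFunction

variable {n m : ℕ} {Ω : Set ((Fin n → ℂ) × (Fin m → ℂ))} {α : Fin n → ℝ}

theorem re_ofReal_div_pos {r : ℝ} (hr : 0 < r) {x : ℂ} (hx : 0 < x.re) : 0 < ((r : ℂ) / x).re := by
  have h : 0 < Complex.normSq x := Complex.normSq_pos.2 (ne_zero_of_re_pos hx)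
  simp only [Complex.div_re, Complex.ofReal_re, Complex.ofReal_im, zero_mul, zero_div, add_zero]
  positivity

theorem differentiableAt_dil_cpw {X : Type*} [NormedAddCommGroup X] [NormedSpace ℂ X]
    {g : X → ℂ} {f : X → (Fin n → ℂ) × (Fin m → ℂ)} {x : X} (hg : DifferentiableAt ℂ g x)
    (hf : DifferentiableAt ℂ f x) (h : 0 < (g x).re) :
    DifferentiableAt ℂ (fun x => dil (cpw α (g x)) (f x)) x := by
  refine DifferentiableAt.prodMk (differentiableAt_pi.2 fun j => ?_) (by fun_prop)
  refine DifferentiableAt.mul (hg.cpow (differentiableAt_const _) (Or.inl h)) ?_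
  exact differentiableAt_pi.1 hf.fst j

/-- The kernel function `K_Ω(· ; p)` pulled back to `U^α` along
`(y, v) ↦ (√(1 - |b|²) / (1 - v b̄)) ^ α y`, which maps the slice over `b` onto `Ω`. The power of
`1 - v b̄` is, up to a constant, the Jacobian determinant of the automorphism of `U^α` over the disc
automorphism exchanging `b` and `0`. -/
noncomputable def pullbackKernel (Ω : Set ((Fin n → ℂ) × (Fin m → ℂ))) (α : Fin n → ℝ) (b : ℂ)
    (p : (Fin n → ℂ) × (Fin m → ℂ)) (x : ((Fin n → ℂ) × (Fin m → ℂ)) × ℂ) : ℂ :=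
  ((1 - x.2 * conj b) ^ ((2 + ∑ j, α j : ℝ) : ℂ))⁻¹ *
    bergmanKernel Ω (dil (cpw α ((rad b : ℂ) / (1 - x.2 * conj b))) x.1) p

theorem norm_rad_div_mul_rad_le {v b : ℂ} (hv : ‖v‖ < 1) (hb : ‖b‖ < 1) :
    ‖(rad b : ℂ) / (1 - v * conj b)‖ * rad v ≤ 1 := by
  have h := norm_pos_iff.2 (one_sub_mul_conj_ne_zero hv hb)
  rw [norm_div, Complex.norm_real, Real.norm_of_nonneg (rad_pos hb).le, div_mul_eq_mul_div,
    div_le_one h, mul_comm]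
  exact rad_mul_rad_le hv hb

theorem rad_div_ne_zero {v b : ℂ} (hv : ‖v‖ < 1) (hb : ‖b‖ < 1) :
    (rad b : ℂ) / (1 - v * conj b) ≠ 0 :=
  div_ne_zero (rad_ne_zero hb) (one_sub_mul_conj_ne_zero hv hb)

theorem IsStarShapedHartogs.dil_rad_div_mem (hΩ : IsStarShapedHartogs Ω) (hα : ∀ j, 0 < α j)
    {b : ℂ} (hb : ‖b‖ < 1) {q : (Fin n → ℂ) × (Fin m → ℂ)} {v : ℂ}
    (hq : (q, v) ∈ domainU α Ω) : dil (cpw α ((rad b : ℂ) / (1 - v * conj b))) q ∈ Ω :=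
  hΩ.dil_cpw_mem_of_slice hα hq (rad_div_ne_zero hq.2 hb) (norm_rad_div_mul_rad_le hq.2 hb)

theorem IsStarShapedHartogs.differentiableOn_pullbackKernel (hΩ : IsStarShapedHartogs Ω)
    (hα : ∀ j, 0 < α j) {b : ℂ} (hb : ‖b‖ < 1) {p : (Fin n → ℂ) × (Fin m → ℂ)} (hp : p ∈ Ω) :
    DifferentiableOn ℂ (pullbackKernel Ω α b p) (domainU α Ω) := by
  intro x hx
  have hre := re_one_sub_mul_conj_pos hx.2 hb
  have h0 : 1 - x.2 * conj b ≠ 0 := one_sub_mul_conj_ne_zero hx.2 hb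
  have h1 : DifferentiableAt ℂ
      (fun x : ((Fin n → ℂ) × (Fin m → ℂ)) × ℂ => 1 - x.2 * conj b) x := by fun_prop
  have h4 : DifferentiableAt ℂ
      (fun x : ((Fin n → ℂ) × (Fin m → ℂ)) × ℂ => (rad b : ℂ) / (1 - x.2 * conj b)) x := by
    simpa only [div_eq_mul_inv] using (h1.fun_inv h0).const_mul (rad b : ℂ)
  have h2 : DifferentiableAt ℂ (fun x : ((Fin n → ℂ) × (Fin m → ℂ)) × ℂ =>
      dil (cpw α ((rad b : ℂ) / (1 - x.2 * conj b))) x.1) x :=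
    differentiableAt_dil_cpw h4 (by fun_prop) (re_ofReal_div_pos (rad_pos hb) hre)
  have h3 := ((differentiableOn_bergmanKernel hΩ.isOpen hp).differentiableAt
    (hΩ.isOpen.mem_nhds (hΩ.dil_rad_div_mem hα hb hx))).comp x h2
  refine DifferentiableAt.differentiableWithinAt (DifferentiableAt.mul ?_ h3)
  refine (h1.cpow (differentiableAt_const _) (Or.inl hre)).inv ?_
  simp [Complex.cpow_eq_zero_iff, h0]

theorem IsStarShapedHartogs.pullbackKernel_mem_bergmanSpace (hΩ : IsStarShapedHartogs Ω)
    (hα : ∀ j, 0 < α j) {b : ℂ} (hb : ‖b‖ < 1) {p : (Fin n → ℂ) × (Fin m → ℂ)} (hp : p ∈ Ω) :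
    pullbackKernel Ω α b p ∈ bergmanSpace (domainU α Ω) := by
  have hd := hΩ.differentiableOn_pullbackKernel hα hb hp
  have hU := isOpen_domainU hΩ.isOpen α
  have hm := hd.continuousOn.aestronglyMeasurable (μ := volume) hU.measurableSet
  refine ⟨hd, memLp_two_of_lintegral hm ?_⟩
  have hK := enorm_sq_lintegral_lt_top (isReproducing_bergmanKernel hΩ.isOpen hp).1.2
  set I := ∫⁻ q in Ω, ‖bergmanKernel Ω q p‖ₑ ^ 2 with hI
  rw [lintegral_domainU hΩ.isOpen (hm.enorm.pow_const 2)]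
  -- the exponents in the Jacobian factor and in the change of variables combine to `|1 - v b̄|⁻⁴`
  have hρ := rad_pos hb
  set C : ℝ := ((1 - ‖b‖) ^ 4 * (rad b ^ 2) ^ ∑ j, α j)⁻¹ with hC
  have hle : ∀ v ∈ ball (0 : ℂ) 1, ∫⁻ q in slice (domainU α Ω) v,
      ‖pullbackKernel Ω α b p (q, v)‖ₑ ^ 2 ≤ ENNReal.ofReal C * I := by
    intro v hv
    have hv : ‖v‖ < 1 := by simpa using hv
    have h0 := one_sub_mul_conj_ne_zero hv hb
    have h0' := norm_pos_iff.2 h0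
    set σ := (rad b : ℂ) / (1 - v * conj b) with hσ
    have hσ0 : σ ≠ 0 := rad_div_ne_zero hv hb
    have hc := cpw_ne_zero α hσ0
    have hprod : 0 < ∏ j, ‖cpw α σ j‖ ^ 2 := prod_norm_sq_pos hc
    have hsub : slice (domainU α Ω) v ⊆ dil (cpw α σ) ⁻¹' Ω := fun q hq =>
      hΩ.dil_rad_div_mem hα hb hq
    have hsl := setLIntegral_dil hc Ω fun q => ‖bergmanKernel Ω q p‖ₑ ^ 2
    rw [← hI] at hsl
    set A := ((1 - v * conj b) ^ ((2 + ∑ j, α j : ℝ) : ℂ))⁻¹ with hA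
    have h2 : ∫⁻ q in dil (cpw α σ) ⁻¹' Ω, ‖bergmanKernel Ω (dil (cpw α σ) q) p‖ₑ ^ 2
        = ENNReal.ofReal (∏ j, ‖cpw α σ j‖ ^ 2)⁻¹ * I := by
      rw [hsl, ← mul_assoc, ← ENNReal.ofReal_mul (by positivity), inv_mul_cancel₀ hprod.ne']
      simp
    calc ∫⁻ q in slice (domainU α Ω) v, ‖pullbackKernel Ω α b p (q, v)‖ₑ ^ 2
        = ‖A‖ₑ ^ 2 * ∫⁻ q in slice (domainU α Ω) v,
            ‖bergmanKernel Ω (dil (cpw α σ) q) p‖ₑ ^ 2 := by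
          rw [← lintegral_const_mul' _ _ (by simp)]
          simp only [pullbackKernel, enorm_mul, mul_pow, ← hA, ← hσ]
      _ ≤ ‖A‖ₑ ^ 2 * (ENNReal.ofReal (∏ j, ‖cpw α σ j‖ ^ 2)⁻¹ * I) := by
          rw [← h2]
          gcongr
      _ ≤ ENNReal.ofReal C * I := by
          rw [← mul_assoc]
          gcongr
          rw [← ofReal_norm, ← ENNReal.ofReal_pow (norm_nonneg _),
            ← ENNReal.ofReal_mul (by positivity)]
          apply ENNReal.ofReal_le_ofReal
          have hlow : 1 - ‖b‖ ≤ ‖1 - v * conj b‖ := by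
            have h1 := norm_sub_norm_le (1 : ℂ) (v * conj b)
            have h2 : ‖v * conj b‖ ≤ ‖b‖ := by
              rw [norm_mul, RCLike.norm_conj]
              nlinarith [norm_nonneg b]
            rw [norm_one] at h1
            linarith
          have e1 : ‖A‖ ^ 2 = (‖1 - v * conj b‖ ^ 4 *
              (‖1 - v * conj b‖ ^ 2) ^ ∑ j, α j)⁻¹ := by
            rw [hA, norm_inv, Complex.norm_cpow_real, Real.rpow_add h0', Real.rpow_two,
              ← Real.rpow_pow_comm h0'.le, inv_pow]
            ring
          have e2 : ∏ j, ‖cpw α σ j‖ ^ 2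
              = (rad b ^ 2) ^ (∑ j, α j) / (‖1 - v * conj b‖ ^ 2) ^ ∑ j, α j := by
            rw [prod_norm_cpw_sq α hσ0, hσ, norm_div, Complex.norm_real,
              Real.norm_of_nonneg hρ.le, div_pow, Real.div_rpow (by positivity) (by positivity)]
          have e3 : 0 < (‖1 - v * conj b‖ ^ 2) ^ ∑ j, α j := by positivity
          have e4 : 0 < (rad b ^ 2) ^ ∑ j, α j := by positivity
          rw [e1, e2, hC, inv_div, mul_inv, mul_inv]
          have e5 : 0 < 1 - ‖b‖ := by linarith
          calc _ = (‖1 - v * conj b‖ ^ 4)⁻¹ * ((rad b ^ 2) ^ ∑ j, α j)⁻¹ := by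
                field_simp
            _ ≤ _ := by gcongr
  calc _ ≤ ∫⁻ v in ball (0 : ℂ) 1, ENNReal.ofReal C * I :=
        setLIntegral_mono' measurableSet_ball hle
    _ < ∞ := by
        rw [setLIntegral_const]
        exact ENNReal.mul_lt_top (ENNReal.mul_lt_top ENNReal.ofReal_lt_top hK) measure_ball_lt_top

theorem dil_cpw_inv_dil_cpw (α : Fin n → ℝ) {r : ℝ} (hr : 0 < r)
    (q : (Fin n → ℂ) × (Fin m → ℂ)) :
    dil (cpw α (r⁻¹ : ℝ)) (dil (cpw α (r : ℂ)) q) = q := by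
  have : (r : ℂ) ≠ 0 := by exact_mod_cast hr.ne'
  rw [dil_cpw_ofReal_mul α (inv_pos.2 hr) this, Complex.ofReal_inv, inv_mul_cancel₀ this, cpw_one,
    dil_one]

/-- On each slice, integration against the pulled back kernel is evaluation at a point, by the
reproducing property in `Ω` after a dilation. -/
theorem IsStarShapedHartogs.integral_slice_pullbackKernel (hΩ : IsStarShapedHartogs Ω)
    (hα : ∀ j, 0 < α j) {b : ℂ} {q : (Fin n → ℂ) × (Fin m → ℂ)} (hq : (q, b) ∈ domainU α Ω)
    {k : (Fin n → ℂ) × (Fin m → ℂ) → ℂ} {v : ℂ} (hv : ‖v‖ < 1)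
    (hk : k ∈ bergmanSpace (slice (domainU α Ω) v)) :
    ∫ x in slice (domainU α Ω) v,
        conj (pullbackKernel Ω α b (dil (cpw α ((rad b)⁻¹ : ℝ)) q) (x, v)) * k x
      = (((1 - ‖v‖ ^ 2) ^ (∑ j, α j) : ℝ) : ℂ) *
        conj (((1 - v * conj b) ^ ((2 + ∑ j, α j : ℝ) : ℂ))⁻¹) *
        k (dil (cpw α (((1 - ‖v‖ ^ 2 : ℝ) : ℂ) / (1 - conj v * b))) q) := by
  obtain ⟨hb, hP⟩ := mem_domainU_iff.1 hq
  set P := dil (cpw α ((rad b)⁻¹ : ℝ)) q with hPdef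
  set s := rad v with hs
  have hs0 : 0 < s := rad_pos hv
  have hsC : (s : ℂ) ≠ 0 := rad_ne_zero hv
  have hc := cpw_ne_zero α hsC
  have hpre : (dil (cpw α (s : ℂ)) ⁻¹' slice (domainU α Ω) v :
      Set ((Fin n → ℂ) × (Fin m → ℂ))) = Ω := by
    rw [slice_domainU hv]
    ext x
    simp only [Set.mem_preimage]
    rw [dil_cpw_inv_dil_cpw α hs0]
  have hk' := comp_dil_mem_bergmanSpace hc hk
  rw [hpre] at hk'
  have hre := re_one_sub_mul_conj_pos hv hb
  set τ := (rad b : ℂ) / (1 - v * conj b) with hτ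
  have hτ0 : τ ≠ 0 := rad_div_ne_zero hv hb
  have hστ : (s : ℂ) * τ ≠ 0 := mul_ne_zero hsC hτ0
  have hnorm : ‖(s : ℂ) * τ‖ ≤ 1 := by
    rw [norm_mul, Complex.norm_real, Real.norm_of_nonneg hs0.le, mul_comm]
    exact norm_rad_div_mul_rad_le hv hb
  have hpos : 0 < ((s : ℂ) * τ).re := by
    rw [Complex.re_ofReal_mul]
    exact mul_pos hs0 (re_ofReal_div_pos (rad_pos hb) hre)
  have hP' : dil (star (cpw α ((s : ℂ) * τ))) P ∈ Ω :=
    hΩ.dil_mem hP fun j => by simpa using norm_cpw_le_one hα hnorm j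
  rw [setIntegral_dil hc, hpre, prod_norm_cpw_sq α hsC, Complex.norm_real,
    Real.norm_of_nonneg hs0.le, hs, rad_sq hv, ← hs, mul_assoc]
  congr 1
  have hcong : ∫ x in Ω, conj (pullbackKernel Ω α b P (dil (cpw α (s : ℂ)) x, v)) *
        k (dil (cpw α (s : ℂ)) x)
      = ∫ x in Ω, conj (((1 - v * conj b) ^ ((2 + ∑ j, α j : ℝ) : ℂ))⁻¹) *
        (conj (bergmanKernel Ω x (dil (star (cpw α ((s : ℂ) * τ))) P)) *
          k (dil (cpw α (s : ℂ)) x)) := by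
    refine setIntegral_congr_fun hΩ.isOpen.measurableSet fun x hx => ?_
    simp only [pullbackKernel]
    rw [← hτ, dil_cpw_mul_ofReal α hs0 hτ0, hΩ.bergmanKernel_dil_cpw hα hx hP hστ hnorm, map_mul,
      mul_assoc]
  rw [hcong, integral_const_mul, ← (isReproducing_bergmanKernel hΩ.isOpen hP').2 _ hk']
  congr 2
  have hconj0 : conj τ ≠ 0 := by simpa using hτ0
  rw [star_cpw α hpos, map_mul, Complex.conj_ofReal, hPdef,
    dil_cpw_mul_ofReal α (inv_pos.2 (rad_pos hb)) (mul_ne_zero hsC hconj0),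
    dil_cpw_ofReal_mul α hs0 (mul_ne_zero (inv_rad_ne_zero hb) (mul_ne_zero hsC hconj0))]
  congr 2
  rw [hτ, ← rad_sq hv, ← hs]
  have := rad_ne_zero hb
  simp only [map_div₀, map_sub, map_one, map_mul, Complex.conj_conj, Complex.conj_ofReal,
    Complex.ofReal_inv, Complex.ofReal_pow]
  field_simp

end TestFunction

/-! ### Disc automorphisms and polar coordinates -/

section Mobius

/-- The automorphism `u ↦ (u + b) / (1 + u b̄)` of the unit disc. -/
noncomputable def mobius (b u : ℂ) : ℂ := (u + b) / (1 + u * conj b)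

variable {b u : ℂ}

theorem re_one_add_mul_conj_pos (hu : ‖u‖ < 1) (hb : ‖b‖ < 1) : 0 < (1 + u * conj b).re := by
  have := re_one_sub_mul_conj_pos (b := -b) hu (by rwa [norm_neg])
  simpa using this

theorem one_add_mul_conj_ne_zero (hu : ‖u‖ < 1) (hb : ‖b‖ < 1) : 1 + u * conj b ≠ 0 :=
  ne_zero_of_re_pos (re_one_add_mul_conj_pos hu hb)

theorem one_sub_norm_mobius_sq (hu : ‖u‖ < 1) (hb : ‖b‖ < 1) :
    1 - ‖mobius b u‖ ^ 2 = (1 - ‖u‖ ^ 2) * (1 - ‖b‖ ^ 2) / ‖1 + u * conj b‖ ^ 2 := by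
  have h0 := norm_pos_iff.2 (one_add_mul_conj_ne_zero hu hb)
  have h := norm_one_sub_mul_conj_sq u (-b)
  simp only [map_neg, mul_neg, sub_neg_eq_add, norm_neg] at h
  rw [mobius, norm_div, div_pow, eq_div_iff (by positivity), sub_mul,
    div_mul_cancel₀ _ (by positivity)]
  linarith

theorem norm_mobius_lt_one (hu : ‖u‖ < 1) (hb : ‖b‖ < 1) : ‖mobius b u‖ < 1 := by
  have h0 := norm_pos_iff.2 (one_add_mul_conj_ne_zero hu hb)
  have h1 := one_sub_norm_sq_pos hu
  have h2 := one_sub_norm_sq_pos hb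
  have h3 : 0 < 1 - ‖mobius b u‖ ^ 2 := by
    rw [one_sub_norm_mobius_sq hu hb]; positivity
  nlinarith [norm_nonneg (mobius b u)]

theorem rad_mobius (hu : ‖u‖ < 1) (hb : ‖b‖ < 1) :
    rad (mobius b u) = rad u * rad b / ‖1 + u * conj b‖ := by
  rw [rad, one_sub_norm_mobius_sq hu hb, Real.sqrt_div (mul_nonneg (one_sub_norm_sq_pos hu).le
    (one_sub_norm_sq_pos hb).le), Real.sqrt_mul (one_sub_norm_sq_pos hu).le,
    Real.sqrt_sq (norm_nonneg _)]
  rfl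

theorem one_sub_conj_mobius_mul (hu : ‖u‖ < 1) (hb : ‖b‖ < 1) :
    1 - conj (mobius b u) * b = ((1 - ‖b‖ ^ 2 : ℝ) : ℂ) / conj (1 + u * conj b) := by
  have h0 : conj (1 + u * conj b) ≠ 0 := (map_ne_zero _).2 (one_add_mul_conj_ne_zero hu hb)
  have h1 : ((‖b‖ : ℂ)) ^ 2 = b * conj b := (Complex.mul_conj' b).symm
  rw [mobius, map_div₀, eq_div_iff h0, sub_mul, div_mul_eq_mul_div, div_mul_cancel₀ _ h0]
  push_cast
  rw [h1]
  simp only [map_add, map_one, map_mul, Complex.conj_conj]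
  ring

theorem one_sub_norm_sq_div_mobius (hu : ‖u‖ < 1) (hb : ‖b‖ < 1) :
    ((1 - ‖mobius b u‖ ^ 2 : ℝ) : ℂ) / (1 - conj (mobius b u) * b)
      = ((1 - ‖u‖ ^ 2 : ℝ) : ℂ) / (1 + u * conj b) := by
  have h0 := one_add_mul_conj_ne_zero hu hb
  have h0' : conj (1 + u * conj b) ≠ 0 := (map_ne_zero _).2 h0
  have hb0 : ((1 - ‖b‖ ^ 2 : ℝ) : ℂ) ≠ 0 := by exact_mod_cast (one_sub_norm_sq_pos hb).ne'
  rw [one_sub_conj_mobius_mul hu hb, one_sub_norm_mobius_sq hu hb, Complex.ofReal_div,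
    Complex.ofReal_mul, Complex.ofReal_pow, ← Complex.mul_conj']
  field_simp

theorem mobius_neg_mobius (hu : ‖u‖ < 1) (hb : ‖b‖ < 1) : mobius (-b) (mobius b u) = u := by
  have h0 := one_add_mul_conj_ne_zero hu hb
  have hb0 : (1 - b * conj b) ≠ 0 := one_sub_mul_conj_ne_zero hb hb
  have h1 : 1 + mobius b u * conj (-b) = (1 - b * conj b) / (1 + u * conj b) := by
    rw [mobius, eq_div_iff h0, add_mul, mul_assoc, mul_comm (conj (-b)), ← mul_assoc,
      div_mul_cancel₀ _ h0, map_neg]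
    ring
  have h2 : mobius b u + -b = u * (1 - b * conj b) / (1 + u * conj b) := by
    rw [mobius, eq_div_iff h0, add_mul, div_mul_cancel₀ _ h0]
    ring
  rw [mobius, h1, h2, div_div_div_cancel_right₀ h0, mul_div_cancel_right₀ _ hb0]

theorem image_mobius_ball (hb : ‖b‖ < 1) : mobius b '' ball 0 1 = ball 0 1 := by
  have hb' : ‖-b‖ < 1 := by rwa [norm_neg]
  ext v
  simp only [Set.mem_image, mem_ball_zero_iff]
  constructor
  · rintro ⟨u, hu, rfl⟩
    exact norm_mobius_lt_one hu hb
  · intro hv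
    refine ⟨mobius (-b) v, norm_mobius_lt_one hv hb', ?_⟩
    have := mobius_neg_mobius hv hb'
    rwa [neg_neg] at this

theorem injOn_mobius (hb : ‖b‖ < 1) : Set.InjOn (mobius b) (ball 0 1) := by
  intro u hu v hv h
  rw [← mobius_neg_mobius (mem_ball_zero_iff.1 hu) hb, h,
    mobius_neg_mobius (mem_ball_zero_iff.1 hv) hb]

theorem hasDerivAt_mobius (hu : ‖u‖ < 1) (hb : ‖b‖ < 1) :
    HasDerivAt (mobius b) (((1 - ‖b‖ ^ 2 : ℝ) : ℂ) / (1 + u * conj b) ^ 2) u := by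
  have h0 := one_add_mul_conj_ne_zero hu hb
  have h1 : HasDerivAt (fun u : ℂ => u + b) 1 u := (hasDerivAt_id u).add_const b
  have h2 : HasDerivAt (fun u : ℂ => 1 + u * conj b) (1 * conj b) u :=
    ((hasDerivAt_id u).mul_const (conj b)).const_add 1
  have h3 := h1.fun_div h2 h0
  have h4 : ((1 - ‖b‖ ^ 2 : ℝ) : ℂ) = 1 * (1 + u * conj b) - (u + b) * (1 * conj b) := by
    push_cast
    rw [← Complex.mul_conj']
    ring
  rw [h4]
  exact h3

/-- Change of variables by a disc automorphism, with the transfer of integrability. -/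
theorem setIntegral_ball_mobius (hb : ‖b‖ < 1) (g : ℂ → ℂ) :
    ∫ v in ball 0 1, g v = ∫ u in ball 0 1,
      ((((1 - ‖b‖ ^ 2) / ‖1 + u * conj b‖ ^ 2) ^ 2 : ℝ) : ℂ) * g (mobius b u) ∧
    (IntegrableOn g (ball 0 1) → IntegrableOn (fun u =>
      ((((1 - ‖b‖ ^ 2) / ‖1 + u * conj b‖ ^ 2) ^ 2 : ℝ) : ℂ) * g (mobius b u)) (ball 0 1)) := by
  let D : ℂ → ℂ →L[ℝ] ℂ := fun u => (ContinuousLinearMap.toSpanSingleton ℂ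
    (((1 - ‖b‖ ^ 2 : ℝ) : ℂ) / (1 + u * conj b) ^ 2)).restrictScalars ℝ
  have hD : ∀ u ∈ ball (0 : ℂ) 1, HasFDerivWithinAt (mobius b) (D u) (ball 0 1) u := fun u hu =>
    ((hasDerivAt_mobius (mem_ball_zero_iff.1 hu) hb).hasFDerivAt.restrictScalars
      ℝ).hasFDerivWithinAt
  have hdet : ∀ u, |(D u).det| = ((1 - ‖b‖ ^ 2) / ‖1 + u * conj b‖ ^ 2) ^ 2 := by
    intro u
    have h1 : ((D u : ℂ →L[ℝ] ℂ) : ℂ →ₗ[ℝ] ℂ) = LinearMap.mulLeft ℝ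
        (((1 - ‖b‖ ^ 2 : ℝ) : ℂ) / (1 + u * conj b) ^ 2) := by
      ext x
      simp [D, mul_comm]
    rw [ContinuousLinearMap.det, h1, abs_det_mulLeft, norm_div, norm_pow, Complex.norm_real,
      Real.norm_of_nonneg (one_sub_norm_sq_pos hb).le]
  have h1 := integral_image_eq_integral_abs_det_fderiv_smul volume measurableSet_ball hD
    (injOn_mobius hb) g
  have h2 := integrableOn_image_iff_integrableOn_abs_det_fderiv_smul volume measurableSet_ball hD
    (injOn_mobius hb) g
  rw [image_mobius_ball hb] at h1 h2
  simp only [hdet, Complex.real_smul] at h1 h2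
  exact ⟨h1, h2.1⟩

end Mobius

section Polar

/-- Integration of a function on the disc whose circular averages are known. -/
theorem setIntegral_ball_of_circleAverage {g : ℂ → ℂ} (hg : IntegrableOn g (ball 0 1))
    (hgc : ContinuousOn g (ball 0 1)) {A : ℝ → ℂ}
    (hA : ∀ r ∈ Set.Ioo (0 : ℝ) 1, Real.circleAverage g 0 r = A (1 - r ^ 2)) :
    ∫ u in ball 0 1, g u = Real.pi * ∫ t in Set.Ioo (0 : ℝ) 1, A t := by
  set f := (ball (0 : ℂ) 1).indicator g with hf
  have hfi : Integrable f := (integrable_indicator_iff measurableSet_ball).2 hg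
  have hfm : Measurable f := by
    classical
    have := hgc.measurable_piecewise (continuousOn_const (c := (0 : ℂ))) measurableSet_ball
    rwa [show (fun _ : ℂ => (0 : ℂ)) = 0 from rfl, Set.piecewise_eq_indicator] at this
  have hsm : Measurable (fun p : ℝ × ℝ => Complex.polarCoord.symm p) := by
    simp only [Complex.polarCoord_symm_apply]
    fun_prop
  have hint : IntegrableOn (fun p : ℝ × ℝ => p.1 • f (Complex.polarCoord.symm p))
      (Set.Ioi 0 ×ˢ Set.Ioo (-Real.pi) Real.pi) := by
    refine ⟨(measurable_fst.smul (hfm.comp hsm)).aestronglyMeasurable, ?_⟩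
    have h1 := Complex.lintegral_comp_polarCoord_symm fun z => ‖f z‖ₑ
    rw [polarCoord_target] at h1
    rw [hasFiniteIntegral_iff_enorm]
    have h2 : ∫⁻ p in Set.Ioi 0 ×ˢ Set.Ioo (-Real.pi) Real.pi,
        ‖p.1 • f (Complex.polarCoord.symm p)‖ₑ = ∫⁻ z, ‖f z‖ₑ := by
      rw [← h1]
      refine setLIntegral_congr_fun (measurableSet_Ioi.prod measurableSet_Ioo) fun p hp => ?_
      have hp0 : (0 : ℝ) < p.1 := hp.1
      simp only [enorm_smul, Real.enorm_eq_ofReal hp0.le, smul_eq_mul]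
    rw [h2]
    exact hfi.2
  rw [← integral_indicator measurableSet_ball, ← hf, ← Complex.integral_comp_polarCoord_symm,
    polarCoord_target, Measure.volume_eq_prod, setIntegral_prod _ hint]
  have hinner : ∀ r ∈ Set.Ioi (0 : ℝ), ∫ θ in Set.Ioo (-Real.pi) Real.pi,
      (r, θ).1 • f (Complex.polarCoord.symm (r, θ))
      = (Set.Ioo (0 : ℝ) 1).indicator (fun r => (2 * Real.pi * r) • A (1 - r ^ 2)) r := by
    intro r hr
    have hr0 : (0 : ℝ) < r := hr
    have hpc : ∀ θ : ℝ, Complex.polarCoord.symm (r, θ) = circleMap 0 r θ := by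
      intro θ
      simp [Complex.polarCoord_symm_apply, circleMap, Complex.exp_mul_I]
    simp only [hpc]
    by_cases hr1 : r < 1
    · have hmem : r ∈ Set.Ioo (0 : ℝ) 1 := ⟨hr0, hr1⟩
      rw [Set.indicator_of_mem hmem, ← hA r hmem, Real.circleAverage_def,
        integral_smul, ← integral_Ioc_eq_integral_Ioo,
        ← intervalIntegral.integral_of_le (by linarith [Real.pi_pos])]
      have hper : Function.Periodic (fun θ => f (circleMap 0 r θ)) (2 * Real.pi) := fun θ => by
        simp only [periodic_circleMap 0 r θ]
      have h3 := hper.intervalIntegral_add_eq (-Real.pi) 0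
      rw [show -Real.pi + 2 * Real.pi = Real.pi by ring, zero_add] at h3
      have h4 : ∀ θ, f (circleMap 0 r θ) = g (circleMap 0 r θ) := fun θ =>
        Set.indicator_of_mem (by simpa [abs_of_pos hr0] using hr1) _
      rw [h3, smul_smul]
      simp only [h4]
      congr 1
      field_simp
    · rw [Set.indicator_of_notMem (fun h => hr1 h.2)]
      have h4 : ∀ θ, f (circleMap 0 r θ) = 0 := fun θ =>
        Set.indicator_of_notMem (by simpa [abs_of_pos hr0] using hr1) _
      simp [h4]
  rw [setIntegral_congr_fun measurableSet_Ioi hinner, setIntegral_indicator measurableSet_Ioo,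
    Set.inter_eq_self_of_subset_right (fun r hr => hr.1)]
  have himg : (fun r : ℝ => 1 - r ^ 2) '' Set.Ioo 0 1 = Set.Ioo 0 1 := by
    ext t
    constructor
    · rintro ⟨r, ⟨h0, h1⟩, rfl⟩
      constructor <;> simp only <;> nlinarith
    · rintro ⟨h0, h1⟩
      refine ⟨√(1 - t), ⟨Real.sqrt_pos.2 (by linarith), ?_⟩, ?_⟩
      · rw [Real.sqrt_lt' one_pos]; linarith
      · simp only [Real.sq_sqrt (show 0 ≤ 1 - t by linarith), sub_sub_cancel]
  have hinj : Set.InjOn (fun r : ℝ => 1 - r ^ 2) (Set.Ioo 0 1) := by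
    intro r hr s hs h
    have h' : r ^ 2 = s ^ 2 := by simp only at h; linarith
    exact (pow_left_inj₀ hr.1.le hs.1.le two_ne_zero).1 h'
  have hder : ∀ r ∈ Set.Ioo (0 : ℝ) 1,
      HasDerivWithinAt (fun r : ℝ => 1 - r ^ 2) (-(2 * r)) (Set.Ioo 0 1) r := by
    intro r _
    have := (hasDerivAt_pow 2 r).const_sub 1
    simpa using this.hasDerivWithinAt
  have h5 := integral_image_eq_integral_abs_deriv_smul measurableSet_Ioo hder hinj A
  rw [himg] at h5
  rw [h5, ← integral_const_mul]
  refine setIntegral_congr_fun measurableSet_Ioo fun r hr => ?_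
  simp only [abs_neg, abs_of_pos (mul_pos two_pos hr.1), Complex.real_smul]
  push_cast
  ring

end Polar

/-! ### Pairing with the pulled back kernel -/

section Pairing

variable {n m : ℕ} {Ω : Set ((Fin n → ℂ) × (Fin m → ℂ))} {α : Fin n → ℝ}

theorem ofReal_div_cpow {r : ℝ} (hr : 0 < r) {x : ℂ} (hx : 0 < x.re) (a : ℝ) :
    ((r : ℂ) / x) ^ (a : ℂ) = ((r ^ a : ℝ) : ℂ) * (x ^ (a : ℂ))⁻¹ := by
  have hx0 := ne_zero_of_re_pos hx
  rw [div_eq_mul_inv, cpow_ofReal_mul hr (inv_ne_zero hx0),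
    Complex.inv_cpow _ _ (arg_ne_pi_of_re_pos hx),
    Complex.ofReal_cpow hr.le]

theorem cpow_two_add {x : ℂ} (hx : x ≠ 0) (a : ℝ) :
    x ^ ((2 + a : ℝ) : ℂ) = x ^ 2 * x ^ (a : ℂ) := by
  rw [Complex.ofReal_add, Complex.cpow_add _ _ hx]
  congr 1
  exact Complex.cpow_ofNat x 2

/-- Splits the weight into a rational factor, absorbed by the Jacobian of the disc automorphism, and
a power of the dilation ratio. -/
theorem rpow_mul_conj_cpow {v b : ℂ} (hv : ‖v‖ < 1) (hb : ‖b‖ < 1) (a : ℝ) :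
    (((1 - ‖v‖ ^ 2) ^ a : ℝ) : ℂ) * conj (((1 - v * conj b) ^ ((2 + a : ℝ) : ℂ))⁻¹)
      = ((1 - conj v * b) ^ 2)⁻¹ * (((1 - ‖v‖ ^ 2 : ℝ) : ℂ) / (1 - conj v * b)) ^ (a : ℂ) := by
  have hre := re_one_sub_mul_conj_pos hv hb
  have hc : conj (1 - v * conj b) = 1 - conj v * b := by simp
  have hre' : 0 < (1 - conj v * b).re := by rw [← hc, Complex.conj_re]; exact hre
  rw [map_inv₀, conj_cpow_ofReal hre, hc, ofReal_div_cpow (one_sub_norm_sq_pos hv) hre',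
    cpow_two_add (ne_zero_of_re_pos hre'), mul_inv]
  ring

variable {q : (Fin n → ℂ) × (Fin m → ℂ)} {b : ℂ}

theorem IsStarShapedHartogs.dil_mobius_mem (hΩ : IsStarShapedHartogs Ω) (hα : ∀ j, 0 < α j)
    (hq : (q, b) ∈ domainU α Ω) {u : ℂ} {r : ℝ} (hr : r < 1) (hu : ‖u‖ ≤ r) :
    (dil (cpw α (((1 - r ^ 2 : ℝ) : ℂ) / (1 + u * conj b))) q, mobius b u) ∈ domainU α Ω := by
  have hb : ‖b‖ < 1 := hq.2
  have hu1 : ‖u‖ < 1 := hu.trans_lt hr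
  have hr0 : 0 ≤ r := (norm_nonneg u).trans hu
  have h0 := one_add_mul_conj_ne_zero hu1 hb
  have h1 : 0 < 1 - r ^ 2 := by nlinarith
  have hrC : ((1 - r ^ 2 : ℝ) : ℂ) ≠ 0 := by exact_mod_cast h1.ne'
  refine hΩ.dil_cpw_mem_domainU hα hq (norm_mobius_lt_one hu1 hb) (div_ne_zero hrC h0) ?_
  rw [rad_mobius hu1 hb, norm_div, Complex.norm_real, Real.norm_of_nonneg h1.le,
    div_mul_eq_mul_div]
  have h2 : 1 - r ^ 2 ≤ rad u := by
    apply Real.le_sqrt_of_sq_le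
    nlinarith [norm_nonneg u]
  have := (rad_pos hb).le
  gcongr

/-- With the radial factor `1 - |u|²` frozen at `1 - r²`, the integrand over the disc is holomorphic
on the closed disc of radius `r`. -/
theorem IsStarShapedHartogs.differentiableAt_comp_mobius (hΩ : IsStarShapedHartogs Ω)
    (hα : ∀ j, 0 < α j) (hq : (q, b) ∈ domainU α Ω)
    {k : ((Fin n → ℂ) × (Fin m → ℂ)) × ℂ → ℂ} (hk : DifferentiableOn ℂ k (domainU α Ω))
    (a : ℝ) {u : ℂ} {r : ℝ} (hr : r < 1) (hu : ‖u‖ ≤ r) :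
    DifferentiableAt ℂ (fun u => ((1 + u * conj b) ^ 2)⁻¹ *
      ((((1 - r ^ 2 : ℝ) : ℂ) / (1 + u * conj b)) ^ (a : ℂ) *
        k (dil (cpw α (((1 - r ^ 2 : ℝ) : ℂ) / (1 + u * conj b))) q, mobius b u))) u := by
  have hb : ‖b‖ < 1 := hq.2
  have hu1 : ‖u‖ < 1 := hu.trans_lt hr
  have hr0 : 0 ≤ r := (norm_nonneg u).trans hu
  have h1 : 0 < 1 - r ^ 2 := by nlinarith
  have h0 := one_add_mul_conj_ne_zero hu1 hb
  have hd : DifferentiableAt ℂ (fun u : ℂ => 1 + u * conj b) u := by fun_prop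
  have hτ : DifferentiableAt ℂ (fun u : ℂ => ((1 - r ^ 2 : ℝ) : ℂ) / (1 + u * conj b)) u := by
    simpa only [div_eq_mul_inv] using (hd.fun_inv h0).const_mul ((1 - r ^ 2 : ℝ) : ℂ)
  have hτre := re_ofReal_div_pos h1 (re_one_add_mul_conj_pos hu1 hb)
  refine ((hd.pow 2).inv (pow_ne_zero 2 h0)).mul (DifferentiableAt.mul
    (hτ.cpow (differentiableAt_const _) (Or.inl hτre)) ?_)
  have h2 := differentiableAt_dil_cpw (α := α) hτ (differentiableAt_const q) hτre
  exact (hk.differentiableAt ((isOpen_domainU hΩ.isOpen α).mem_nhds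
    (hΩ.dil_mobius_mem hα hq hr hu))).comp u (h2.prodMk (hasDerivAt_mobius hu1 hb).differentiableAt)

theorem IsStarShapedHartogs.continuousAt_comp_mobius (hΩ : IsStarShapedHartogs Ω)
    (hα : ∀ j, 0 < α j) (hq : (q, b) ∈ domainU α Ω)
    {k : ((Fin n → ℂ) × (Fin m → ℂ)) × ℂ → ℂ} (hk : DifferentiableOn ℂ k (domainU α Ω))
    (a : ℝ) {u : ℂ} (hu : ‖u‖ < 1) :
    ContinuousAt (fun u => ((1 + u * conj b) ^ 2)⁻¹ *
      ((((1 - ‖u‖ ^ 2 : ℝ) : ℂ) / (1 + u * conj b)) ^ (a : ℂ) *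
        k (dil (cpw α (((1 - ‖u‖ ^ 2 : ℝ) : ℂ) / (1 + u * conj b))) q, mobius b u))) u := by
  have hb : ‖b‖ < 1 := hq.2
  have h1 := one_sub_norm_sq_pos hu
  have h0 := one_add_mul_conj_ne_zero hu hb
  have hd : ContinuousAt (fun u : ℂ => 1 + u * conj b) u := by fun_prop
  have hτ : ContinuousAt (fun u : ℂ => ((1 - ‖u‖ ^ 2 : ℝ) : ℂ) / (1 + u * conj b)) u :=
    ContinuousAt.div (by fun_prop) hd h0
  have hτre := re_ofReal_div_pos h1 (re_one_add_mul_conj_pos hu hb)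
  have hpow : ∀ a : ℝ, ContinuousAt
      (fun u : ℂ => (((1 - ‖u‖ ^ 2 : ℝ) : ℂ) / (1 + u * conj b)) ^ (a : ℂ)) u := fun a =>
    hτ.cpow continuousAt_const (Or.inl hτre)
  refine ((hd.pow 2).inv₀ (pow_ne_zero 2 h0)).mul (ContinuousAt.mul (hpow a) ?_)
  have h2 : ContinuousAt (fun u : ℂ =>
      dil (cpw α (((1 - ‖u‖ ^ 2 : ℝ) : ℂ) / (1 + u * conj b))) q) u :=
    ContinuousAt.prodMk (continuousAt_pi.2 fun j => (hpow (α j)).mul continuousAt_const)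
      continuousAt_const
  have h3 := (hk.continuousOn.continuousAt ((isOpen_domainU hΩ.isOpen α).mem_nhds
    (hΩ.dil_mobius_mem hα hq hu le_rfl)))
  exact ContinuousAt.comp (f := fun u : ℂ =>
    (dil (cpw α (((1 - ‖u‖ ^ 2 : ℝ) : ℂ) / (1 + u * conj b))) q, mobius b u)) h3
    (h2.prodMk (hasDerivAt_mobius hu hb).continuousAt)

/-- Pairing a function of the Bergman space with the pulled back kernel. After integration over
the slices, the disc automorphism moving `0` to `b` turns the integrand into a function which is
holomorphic on circles up to radial factors, so only its value at the centre contributes. -/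
theorem IsStarShapedHartogs.integral_conj_pullbackKernel_mul (hΩ : IsStarShapedHartogs Ω)
    (hα : ∀ j, 0 < α j) (hq : (q, b) ∈ domainU α Ω)
    {k : ((Fin n → ℂ) × (Fin m → ℂ)) × ℂ → ℂ} (hk : k ∈ bergmanSpace (domainU α Ω)) :
    ∫ x in domainU α Ω, conj (pullbackKernel Ω α b (dil (cpw α ((rad b)⁻¹ : ℝ)) q) x) * k x
      = Real.pi * ∫ t in Set.Ioo (0 : ℝ) 1,
        (t : ℂ) ^ ((∑ j, α j : ℝ) : ℂ) * k (dil (cpw α (t : ℂ)) q, b) := by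
  obtain ⟨hb, hP⟩ := mem_domainU_iff.1 hq
  set a := ∑ j, α j with ha
  let H : ℂ → ℂ → ℂ := fun τ v => τ ^ (a : ℂ) * k (dil (cpw α τ) q, v)
  let G : ℂ → ℂ := fun v =>
    ((1 - conj v * b) ^ 2)⁻¹ * H (((1 - ‖v‖ ^ 2 : ℝ) : ℂ) / (1 - conj v * b)) v
  let Ψ : ℂ → ℂ := fun u =>
    ((1 + u * conj b) ^ 2)⁻¹ * H (((1 - ‖u‖ ^ 2 : ℝ) : ℂ) / (1 + u * conj b)) (mobius b u)
  have hf := hΩ.pullbackKernel_mem_bergmanSpace hα hb hP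
  have hint : IntegrableOn (fun x =>
      conj (pullbackKernel Ω α b (dil (cpw α ((rad b)⁻¹ : ℝ)) q) x) * k x) (domainU α Ω) :=
    MemLp.integrable_mul (p := 2) (q := 2) hf.2.star hk.2
  have hae : ∀ᵐ v ∂(volume.restrict (ball (0 : ℂ) 1)),
      ∫ x in slice (domainU α Ω) v,
        conj (pullbackKernel Ω α b (dil (cpw α ((rad b)⁻¹ : ℝ)) q) (x, v)) * k (x, v) = G v := by
    filter_upwards [ae_slice_mem_bergmanSpace hΩ.isOpen hk,
      ae_restrict_mem measurableSet_ball] with v hv hv1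
    have hv1 : ‖v‖ < 1 := mem_ball_zero_iff.1 hv1
    rw [hΩ.integral_slice_pullbackKernel hα hq hv1 hv, rpow_mul_conj_cpow hv1 hb, mul_assoc]
  have hGi : IntegrableOn G (ball 0 1) :=
    (integrableOn_integral_slice hΩ.isOpen hint).congr hae
  obtain ⟨hcv, hcvi⟩ := setIntegral_ball_mobius hb G
  have hΨ : ∀ u ∈ ball (0 : ℂ) 1,
      ((((1 - ‖b‖ ^ 2) / ‖1 + u * conj b‖ ^ 2) ^ 2 : ℝ) : ℂ) * G (mobius b u) = Ψ u := by
    intro u hu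
    have hu1 : ‖u‖ < 1 := mem_ball_zero_iff.1 hu
    have h0 := one_add_mul_conj_ne_zero hu1 hb
    have h0' : conj (1 + u * conj b) ≠ 0 := (map_ne_zero _).2 h0
    have hb0 : ((1 - ‖b‖ ^ 2 : ℝ) : ℂ) ≠ 0 := by exact_mod_cast (one_sub_norm_sq_pos hb).ne'
    simp only [G, Ψ]
    rw [one_sub_norm_sq_div_mobius hu1 hb, ← mul_assoc, one_sub_conj_mobius_mul hu1 hb]
    congr 1
    rw [Complex.ofReal_pow, Complex.ofReal_div, Complex.ofReal_pow ‖_‖, ← Complex.mul_conj']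
    field_simp
  have hΨi : IntegrableOn Ψ (ball 0 1) :=
    (hcvi hGi).congr_fun hΨ measurableSet_ball
  have hcirc : ∀ r ∈ Set.Ioo (0 : ℝ) 1,
      Real.circleAverage Ψ 0 r = H ((1 - r ^ 2 : ℝ) : ℂ) b := by
    intro r hr
    let Ψr : ℂ → ℂ := fun u => ((1 + u * conj b) ^ 2)⁻¹ *
      H (((1 - r ^ 2 : ℝ) : ℂ) / (1 + u * conj b)) (mobius b u)
    have h1 : Real.circleAverage Ψ 0 r = Real.circleAverage Ψr 0 r := by
      simp only [Real.circleAverage_def, Ψ, Ψr, norm_circleMap_zero, sq_abs]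
    have h2 : DiffContOnCl ℂ Ψr (ball 0 |r|) := by
      apply DifferentiableOn.diffContOnCl
      intro u hu
      have hu' : ‖u‖ ≤ r := by
        have := closure_ball_subset_closedBall hu
        simpa [abs_of_pos hr.1] using this
      exact (hΩ.differentiableAt_comp_mobius hα hq hk.1 a hr.2 hu').differentiableWithinAt
    rw [h1, h2.circleAverage]
    simp [Ψr, mobius]
  rw [integral_domainU hΩ.isOpen hint, integral_congr_ae hae, hcv,
    setIntegral_congr_fun measurableSet_ball hΨ,
    setIntegral_ball_of_circleAverage hΨi (A := fun t => H (t : ℂ) b) _ hcirc]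
  exact fun u hu => (hΩ.continuousAt_comp_mobius hα hq hk.1 a
    (mem_ball_zero_iff.1 hu)).continuousWithinAt

end Pairing

/-! ### Slice kernels and the Euler operator -/

section SliceKernel

variable {n m : ℕ} {Ω : Set ((Fin n → ℂ) × (Fin m → ℂ))} {α : Fin n → ℝ}

theorem one_sub_norm_sq_div_ne_zero {w η : ℂ} (hw : ‖w‖ < 1) (hη : ‖η‖ < 1) :
    ((1 - ‖η‖ ^ 2 : ℝ) : ℂ) / (1 - w * conj η) ≠ 0 := by
  have : ((1 - ‖η‖ ^ 2 : ℝ) : ℂ) ≠ 0 := by exact_mod_cast (one_sub_norm_sq_pos hη).ne'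
  exact div_ne_zero this (one_sub_mul_conj_ne_zero hw hη)

theorem IsStarShapedHartogs.dil_mem_slice (hΩ : IsStarShapedHartogs Ω) (hα : ∀ j, 0 < α j)
    {q : (Fin n → ℂ) × (Fin m → ℂ)} {w η : ℂ} (hq : (q, w) ∈ domainU α Ω) (hη : ‖η‖ < 1) :
    dil (cpw α (((1 - ‖η‖ ^ 2 : ℝ) : ℂ) / (1 - w * conj η))) q ∈ slice (domainU α Ω) η := by
  have hw : ‖w‖ < 1 := hq.2
  have hN := norm_pos_iff.2 (one_sub_mul_conj_ne_zero hw hη)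
  have hs := rad_pos hη
  refine hΩ.dil_cpw_mem_domainU hα hq hη (one_sub_norm_sq_div_ne_zero hw hη) ?_
  rw [← rad_sq hη, norm_div, Complex.norm_real, Real.norm_of_nonneg (by positivity),
    div_mul_eq_mul_div, div_le_iff₀ hN]
  nlinarith [rad_mul_rad_le hw hη]

theorem IsStarShapedHartogs.dil_mem_domainU (hΩ : IsStarShapedHartogs Ω)
    {q : (Fin n → ℂ) × (Fin m → ℂ)} {w : ℂ} (hq : (q, w) ∈ domainU α Ω) {c : Fin n → ℂ}
    (hc : ∀ j, ‖c j‖ ≤ 1) : (dil c q, w) ∈ domainU α Ω := by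
  obtain ⟨hw, hq⟩ := mem_domainU_iff.1 hq
  refine mem_domainU_iff.2 ⟨hw, ?_⟩
  rw [dil_dil, mul_comm, ← dil_dil]
  exact hΩ.dil_mem hq hc

/-- The kernel of the slice over `η` in terms of the kernel of `Ω`; the dilation coming from `h` is
shared between the two variables so that the first point is the normalization of `q` in the slice
over `w`. -/
theorem IsStarShapedHartogs.bergmanKernel_slice (hΩ : IsStarShapedHartogs Ω)
    (hα : ∀ j, 0 < α j) {q p : (Fin n → ℂ) × (Fin m → ℂ)} {w η : ℂ}
    (hq : (q, w) ∈ domainU α Ω) (hp : (p, η) ∈ domainU α Ω) :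
    bergmanKernel (slice (domainU α Ω) η)
        (dil (cpw α (((1 - ‖η‖ ^ 2 : ℝ) : ℂ) / (1 - w * conj η))) q) p
      = (((1 - ‖η‖ ^ 2) ^ (∑ j, α j) : ℝ) : ℂ)⁻¹ *
        bergmanKernel Ω (dil (cpw α ((rad w)⁻¹ : ℝ)) q)
          (dil (cpw α ((rad w : ℂ) / (1 - η * conj w))) p) := by
  obtain ⟨hw, hP⟩ := mem_domainU_iff.1 hq
  obtain ⟨hη, hQ⟩ := mem_domainU_iff.1 hp
  have hmem := hΩ.dil_mem_slice hα hq hη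
  have hs := rad_pos hη
  have hρ := rad_pos hw
  have hsC := rad_ne_zero hη
  have hρC := rad_ne_zero hw
  have hN := one_sub_mul_conj_ne_zero hw hη
  have hcN : conj (1 - w * conj η) = 1 - η * conj w := by simp [mul_comm]
  have hτ := rad_div_ne_zero hη hw
  rw [slice_domainU hη] at hmem ⊢
  rw [bergmanKernel_dil (cpw_ne_zero α (inv_rad_ne_zero hη)) hΩ.isOpen hmem hQ,
    prod_norm_cpw_sq α (inv_rad_ne_zero hη), Complex.norm_real,
    Real.norm_of_nonneg (inv_pos.2 hs).le, inv_pow, rad_sq hη,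
    Real.inv_rpow (one_sub_norm_sq_pos hη).le, Complex.ofReal_inv]
  congr 1
  set σ : ℂ := (rad η : ℂ) * ((rad w : ℂ) / (1 - w * conj η)) with hσ
  have hσ0 : σ ≠ 0 := mul_ne_zero hsC (div_ne_zero hρC hN)
  have hσ1 : ‖σ‖ ≤ 1 := by
    rw [hσ, norm_mul, norm_div, Complex.norm_real, Complex.norm_real, Real.norm_of_nonneg hs.le,
      Real.norm_of_nonneg hρ.le, mul_div_assoc', div_le_one (norm_pos_iff.2 hN), mul_comm]
    exact rad_mul_rad_le hw hη
  have hσre : 0 < σ.re := by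
    rw [hσ, Complex.re_ofReal_mul]
    exact mul_pos hs (re_ofReal_div_pos hρ (re_one_sub_mul_conj_pos hw hη))
  have hx : dil (cpw α ((rad η)⁻¹ : ℝ))
      (dil (cpw α (((1 - ‖η‖ ^ 2 : ℝ) : ℂ) / (1 - w * conj η))) q)
      = dil (cpw α σ) (dil (cpw α ((rad w)⁻¹ : ℝ)) q) := by
    rw [dil_cpw_ofReal_mul α (inv_pos.2 hs) (one_sub_norm_sq_div_ne_zero hw hη),
      dil_cpw_mul_ofReal α (inv_pos.2 hρ) hσ0, ← rad_sq hη, hσ]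
    congr 2
    push_cast
    field_simp
  rw [hx, hΩ.bergmanKernel_dil_cpw hα hP hQ hσ0 hσ1, star_cpw α hσre,
    dil_cpw_mul_ofReal α (inv_pos.2 hs) ((map_ne_zero _).2 hσ0)]
  congr 3
  rw [hσ, map_mul, map_div₀, hcN, Complex.conj_ofReal, Complex.conj_ofReal, Complex.ofReal_inv,
    ← mul_assoc, inv_mul_cancel₀ hsC, one_mul]

/-- The slice kernel is a weighted integral of the kernel of `U^α` along a dilation orbit. -/
theorem IsStarShapedHartogs.bergmanKernel_slice_eq_integral (hΩ : IsStarShapedHartogs Ω)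
    (hα : ∀ j, 0 < α j) {q p : (Fin n → ℂ) × (Fin m → ℂ)} {w η : ℂ}
    (hq : (q, w) ∈ domainU α Ω) (hp : (p, η) ∈ domainU α Ω) :
    bergmanKernel (slice (domainU α Ω) η)
        (dil (cpw α (((1 - ‖η‖ ^ 2 : ℝ) : ℂ) / (1 - w * conj η))) q) p
      = (Real.pi : ℂ) * (1 - w * conj η) ^ ((2 + ∑ j, α j : ℝ) : ℂ) /
          (((1 - ‖η‖ ^ 2) ^ (∑ j, α j) : ℝ) : ℂ) *
        ∫ t in Set.Ioo (0 : ℝ) 1, (t : ℂ) ^ ((∑ j, α j : ℝ) : ℂ) *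
          bergmanKernel (domainU α Ω) (dil (cpw α (t : ℂ)) q, w) (p, η) := by
  obtain ⟨hw, hP⟩ := mem_domainU_iff.1 hq
  obtain ⟨hη, hQ⟩ := mem_domainU_iff.1 hp
  have hU := isOpen_domainU hΩ.isOpen α
  have hf := hΩ.pullbackKernel_mem_bergmanSpace hα hw hP
  have h1 := hΩ.integral_conj_pullbackKernel_mul hα hq (isReproducing_bergmanKernel hU hp).1
  rw [integral_conj_mul_bergmanKernel hU hp hf] at h1
  have hN := one_sub_mul_conj_ne_zero hw hη
  have hcN : conj (1 - η * conj w) = 1 - w * conj η := by simp [mul_comm]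
  have hpow : (1 - w * conj η) ^ ((2 + ∑ j, α j : ℝ) : ℂ) ≠ 0 := by
    simp [Complex.cpow_eq_zero_iff, hN]
  simp only [pullbackKernel] at h1
  rw [map_mul, map_inv₀, conj_cpow_ofReal (re_one_sub_mul_conj_pos hη hw), hcN,
    ← bergmanKernel_conj_symm hΩ.isOpen hP (hΩ.dil_rad_div_mem hα hw hp),
    inv_mul_eq_iff_eq_mul₀ hpow] at h1
  rw [hΩ.bergmanKernel_slice hα hq hp, h1]
  ring

end SliceKernel

section Euler

variable {n m : ℕ} {α : Fin n → ℝ}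

theorem partialDeriv_eq_fderiv {F : (Fin n → ℂ) → ℂ} {z : Fin n → ℂ}
    (hF : DifferentiableAt ℂ F z) (j : Fin n) :
    partialDeriv j F z = fderiv ℂ F z (Pi.single j 1) := by
  have h1 : HasDerivAt (Function.update z j) (Pi.single j (1 : ℂ)) (z j) := hasDerivAt_update z j _
  have h2 : HasFDerivAt F (fderiv ℂ F z) (Function.update z j (z j)) := by
    rw [Function.update_eq_self]; exact hF.hasFDerivAt
  exact (h2.comp_hasDerivAt (z j) h1).deriv

theorem hasDerivAt_ofReal_cpow_one (a : ℂ) :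
    HasDerivAt (fun s : ℝ => (s : ℂ) ^ a) a 1 := by
  have h : HasDerivAt (fun s : ℂ => s ^ a) (a * (1 : ℂ) ^ (a - 1)) ((1 : ℝ) : ℂ) := by
    have := (hasDerivAt_id ((1 : ℝ) : ℂ)).cpow_const (c := a) (Or.inl (by simp))
    simpa using this
  simpa using h.comp_ofReal

/-- Euler's identity: the derivative at `s = 1` of `s ^ (1 + |α|) F (s ^ α z)` is the weighted
Euler operator applied to `F`. -/
theorem hasDerivAt_euler {F : (Fin n → ℂ) → ℂ} {z : Fin n → ℂ} (hF : DifferentiableAt ℂ F z) :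
    HasDerivAt (fun s : ℝ => (s : ℂ) ^ ((1 + ∑ j, α j : ℝ) : ℂ) *
        F (fun j => cpw α (s : ℂ) j * z j))
      (F z + ∑ j, (α j : ℂ) * (F z + z j * partialDeriv j F z)) 1 := by
  have h1 : HasDerivAt (fun s : ℝ => fun j => cpw α (s : ℂ) j * z j)
      (fun j => (α j : ℂ) * z j) 1 :=
    hasDerivAt_pi.2 fun j => (hasDerivAt_ofReal_cpow_one (α j : ℂ)).mul_const (z j)
  have hz : (fun j => cpw α 1 j * z j) = z := by
    simp [cpw_one]
  have h2 : HasFDerivAt F ((fderiv ℂ F z).restrictScalars ℝ)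
      ((fun s : ℝ => fun j => cpw α (s : ℂ) j * z j) 1) := by
    simp only [Complex.ofReal_one, hz]; exact hF.hasFDerivAt.restrictScalars ℝ
  have h3 := (hasDerivAt_ofReal_cpow_one ((1 + ∑ j, α j : ℝ) : ℂ)).mul (h2.comp_hasDerivAt 1 h1)
  refine h3.congr_deriv ?_
  have h4 : (fun j => (α j : ℂ) * z j) = ∑ j, ((α j : ℂ) * z j) • Pi.single j (1 : ℂ) := by
    ext i
    simp [Finset.sum_apply, Pi.single_apply]
  have h5 : fderiv ℂ F z (fun j => (α j : ℂ) * z j)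
      = ∑ j, (α j : ℂ) * z j * partialDeriv j F z := by
    rw [h4, map_sum]
    simp [partialDeriv_eq_fderiv hF]
  simp only [Function.comp, ContinuousLinearMap.coe_restrictScalars', h5, hz, Complex.ofReal_one,
    Complex.one_cpow, one_mul, mul_add, Finset.sum_add_distrib, ← Finset.sum_mul]
  push_cast
  simp only [mul_assoc]
  ring

/-- Inversion of the averaging operator `g ↦ ∫₀¹ t ^ |α| g (t ^ α z) dt` by the weighted Euler
operator. -/
theorem euler_eq_of_integral {F : (Fin n → ℂ) → ℂ} {z : Fin n → ℂ}
    (hF : DifferentiableAt ℂ F z) {g : (Fin n → ℂ) → ℂ}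
    (hg : ContinuousOn (fun t : ℝ => (t : ℂ) ^ ((∑ j, α j : ℝ) : ℂ) *
      g (fun j => cpw α (t : ℂ) j * z j)) (Set.Icc 0 1))
    (h : ∀ s ∈ Set.Ioc (0 : ℝ) 1, F (fun j => cpw α (s : ℂ) j * z j)
      = ∫ t in Set.Ioo (0 : ℝ) 1, (t : ℂ) ^ ((∑ j, α j : ℝ) : ℂ) *
          g (fun j => cpw α (t : ℂ) j * (cpw α (s : ℂ) j * z j))) :
    F z + ∑ j, (α j : ℂ) * (F z + z j * partialDeriv j F z) = g z := by
  set a := ∑ j, α j with ha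
  set H : ℝ → ℂ := fun t => (t : ℂ) ^ (a : ℂ) * g (fun j => cpw α (t : ℂ) j * z j) with hH
  have hH1 : H 1 = g z := by simp [hH, cpw]
  have hint : IntervalIntegrable H volume 0 1 :=
    ContinuousOn.intervalIntegrable (by rwa [Set.uIcc_of_le zero_le_one])
  have hcont : ContinuousWithinAt H (Set.Iic 1) 1 :=
    (hg 1 (by simp)).mono_of_mem_nhdsWithin (Icc_mem_nhdsLE zero_lt_one)
  have hmeas : StronglyMeasurableAtFilter H (𝓝[≤] 1) volume :=
    ⟨Set.Icc 0 1, Icc_mem_nhdsLE zero_lt_one, hg.aestronglyMeasurable measurableSet_Icc⟩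
  have h1 : HasDerivWithinAt (fun s => ∫ t in (0 : ℝ)..s, H t) (H 1) (Set.Iic 1) 1 :=
    intervalIntegral.integral_hasDerivWithinAt_right hint hmeas hcont
  have h2 := (hasDerivAt_euler (α := α) hF).hasDerivWithinAt (s := Set.Iic 1)
  have heq : ∀ s ∈ Set.Ioc (0 : ℝ) 1, (s : ℂ) ^ ((1 + a : ℝ) : ℂ) *
      F (fun j => cpw α (s : ℂ) j * z j) = ∫ t in (0 : ℝ)..s, H t := by
    intro s hs
    have hs0 : (s : ℂ) ≠ 0 := by exact_mod_cast hs.1.ne'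
    have h3 : ∀ t ∈ Set.Ioo (0 : ℝ) 1, (t : ℂ) ^ (a : ℂ) *
        g (fun j => cpw α (t : ℂ) j * (cpw α (s : ℂ) j * z j))
        = ((s : ℂ) ^ (a : ℂ))⁻¹ * H (t * s) := by
      intro t ht
      have e1 : ((t * s : ℝ) : ℂ) ^ (a : ℂ) = (t : ℂ) ^ (a : ℂ) * (s : ℂ) ^ (a : ℂ) := by
        rw [Complex.ofReal_mul, cpow_ofReal_mul ht.1 hs0]
      have e2 : cpw α ((t * s : ℝ) : ℂ) = cpw α (t : ℂ) * cpw α (s : ℂ) := by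
        rw [Complex.ofReal_mul, cpw_ofReal_mul α ht.1 hs0]
      have e3 : (s : ℂ) ^ (a : ℂ) ≠ 0 := by simp [Complex.cpow_eq_zero_iff, hs0]
      simp only [hH]
      rw [e1, e2]
      simp only [Pi.mul_apply, mul_assoc]
      field_simp
    rw [h s hs, setIntegral_congr_fun measurableSet_Ioo h3, ← integral_Ioc_eq_integral_Ioo,
      ← intervalIntegral.integral_of_le zero_le_one, intervalIntegral.integral_const_mul,
      intervalIntegral.integral_comp_mul_right H hs.1.ne', zero_mul, one_mul, Complex.real_smul,
      Complex.ofReal_add, Complex.cpow_add _ _ hs0, Complex.ofReal_one, Complex.cpow_one]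
    have e3 : (s : ℂ) ^ (a : ℂ) ≠ 0 := by simp [Complex.cpow_eq_zero_iff, hs0]
    push_cast
    field_simp
  have h3 : HasDerivWithinAt (fun s : ℝ => (s : ℂ) ^ ((1 + a : ℝ) : ℂ) *
      F (fun j => cpw α (s : ℂ) j * z j)) (H 1) (Set.Iic 1) 1 := by
    -- the integral formula is available for `s ≤ 1` only, hence the one-sided derivative
    refine h1.congr_of_eventuallyEq ?_ (heq 1 (by simp))
    filter_upwards [Ioc_mem_nhdsLE zero_lt_one] with s hs using heq s hs
  rw [← hH1]
  exact (uniqueDiffWithinAt_Iic 1).eq_deriv _ h2 h3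

theorem continuous_ofReal_cpow {a : ℝ} (ha : 0 ≤ a) :
    Continuous fun t : ℝ => (t : ℂ) ^ (a : ℂ) := by
  -- for `a = 0` the convention `0 ^ 0 = 1` makes the function constant
  rcases ha.eq_or_lt with rfl | ha
  · simpa using continuous_const
  · exact Complex.continuous_ofReal_cpow_const (by simpa using ha)

theorem continuous_dil_cpw (hα : ∀ j, 0 < α j) (q : (Fin n → ℂ) × (Fin m → ℂ)) :
    Continuous fun t : ℝ => dil (cpw α (t : ℂ)) q :=
  Continuous.prodMk (continuous_pi fun j => (continuous_ofReal_cpow (hα j).le).mul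
    continuous_const) continuous_const

end Euler

end Bergman

theorem theorem1 {n m : ℕ} (Ω : Set ((Fin n → ℂ) × (Fin m → ℂ)))
    (hΩ : Bergman.IsStarShapedHartogs Ω) (α : Fin n → ℝ) (hα : ∀ j, 0 < α j)
    (z ζ : Fin n → ℂ) (z' ζ' : Fin m → ℂ) (w η : ℂ)
    (hz : ((z, z'), w) ∈ Bergman.domainU α Ω) (hζ : ((ζ, ζ'), η) ∈ Bergman.domainU α Ω) :
    IsOpen (Bergman.domainU α Ω) ∧
    IsOpen (Bergman.slice (Bergman.domainU α Ω) η) ∧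
    (Bergman.hMap α z w η, z') ∈ Bergman.slice (Bergman.domainU α Ω) η ∧
    DifferentiableAt ℂ
      (fun x => Bergman.bergmanKernel (Bergman.slice (Bergman.domainU α Ω) η)
        (Bergman.hMap α x w η, z') (ζ, ζ')) z ∧
    Bergman.bergmanKernel (Bergman.domainU α Ω) ((z, z'), w) ((ζ, ζ'), η) =
      Bergman.operatorD α w η
        (fun x => Bergman.bergmanKernel (Bergman.slice (Bergman.domainU α Ω) η)
          (Bergman.hMap α x w η, z') (ζ, ζ')) z := by
  open Bergman in
  have hw : ‖w‖ < 1 := hz.2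
  have hη : ‖η‖ < 1 := hζ.2
  have hU := isOpen_domainU hΩ.isOpen α
  have hS := isOpen_slice hU η
  have hhz : (hMap α z w η, z') ∈ slice (domainU α Ω) η := by
    rw [hMap_eq_dil α (z, z') w η]
    exact hΩ.dil_mem_slice hα hz hη
  have hdiff : DifferentiableAt ℂ (fun x => bergmanKernel (slice (domainU α Ω) η)
      (hMap α x w η, z') (ζ, ζ')) z := by
    have h1 : DifferentiableAt ℂ (fun x : Fin n → ℂ => (hMap α x w η, z')) z := by
      unfold hMap
      fun_prop
    exact DifferentiableAt.comp (g := fun y => bergmanKernel (slice (domainU α Ω) η) y (ζ, ζ')) z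
      ((differentiableOn_bergmanKernel hS hζ).differentiableAt (hS.mem_nhds hhz)) h1
  refine ⟨hU, hS, hhz, hdiff, ?_⟩
  have hN := one_sub_mul_conj_ne_zero hw hη
  set k := fun x => bergmanKernel (domainU α Ω) x ((ζ, ζ'), η) with hk
  have hkd : DifferentiableOn ℂ k (domainU α Ω) := differentiableOn_bergmanKernel hU hζ
  set C : ℂ := (Real.pi : ℂ) * (1 - w * conj η) ^ ((2 + ∑ j, α j : ℝ) : ℂ) /
    (((1 - ‖η‖ ^ 2) ^ (∑ j, α j) : ℝ) : ℂ) with hC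
  have hC0 : C ≠ 0 := by
    have h1 : (1 - w * conj η) ^ ((2 + ∑ j, α j : ℝ) : ℂ) ≠ 0 := by
      simp [Complex.cpow_eq_zero_iff, hN]
    have h2 : (((1 - ‖η‖ ^ 2) ^ (∑ j, α j) : ℝ) : ℂ) ≠ 0 := by
      exact_mod_cast (Real.rpow_pos_of_pos (one_sub_norm_sq_pos hη) _).ne'
    exact div_ne_zero (mul_ne_zero (by exact_mod_cast Real.pi_ne_zero) h1) h2
  have hle : ∀ t ∈ Set.Icc (0 : ℝ) 1, ∀ j, ‖cpw α (t : ℂ) j‖ ≤ 1 := fun t ht =>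
    norm_cpw_le_one hα (by rw [Complex.norm_real, Real.norm_of_nonneg ht.1]; exact ht.2)
  have hcont : ContinuousOn (fun t : ℝ => (t : ℂ) ^ ((∑ j, α j : ℝ) : ℂ) *
      (C * k ((fun j => cpw α (t : ℂ) j * z j, z'), w))) (Set.Icc 0 1) := by
    refine (continuous_ofReal_cpow (Finset.sum_nonneg fun j _ => (hα j).le)).continuousOn.mul
      (continuousOn_const.mul ?_)
    exact hkd.continuousOn.comp ((continuous_dil_cpw hα (z, z')).prodMk
      continuous_const).continuousOn fun t ht => hΩ.dil_mem_domainU hz (hle t ht)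
  have heuler := euler_eq_of_integral (α := α) hdiff (g := fun x => C * k ((x, z'), w)) hcont
    (fun s hs => by
      have hs' : (dil (cpw α (s : ℂ)) (z, z'), w) ∈ domainU α Ω :=
        hΩ.dil_mem_domainU hz (hle s ⟨hs.1.le, hs.2⟩)
      have h := hΩ.bergmanKernel_slice_eq_integral hα hs' hζ
      rw [← hC, ← hMap_eq_dil, ← integral_const_mul] at h
      refine h.trans (integral_congr_ae (Eventually.of_forall fun t => ?_))
      simp only [hk, dil]
      ring)
  rw [operatorD, heuler, ← mul_assoc, ← inv_div, ← hC, inv_mul_cancel₀ hC0, one_mul]
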